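/- **Theorem (scalar multiple, product, power and quotient of independent stable subordinators).** For $0\le m\le q$, $0\le n\le p$, $a_i,b_j\in\mathbb C$, $A_i,B_j>0$ and $z>0$, the Fox $H$-function is $$H^{m,n}_{p,q}\left[z\,\middle|\,\begin{matrix}(a_i,A_i)_{1,p}\\(b_j,B_j)_{1,q}\end{matrix}\right]=\frac1{2\pi i}\int_{c-i\infty}^{c+i\infty}\chi(s)z^{-s}\,ds,\qquad \chi(s)=\frac{\prod_{i=1}^{n}\Gamma(1-a_i-A_is)\prod_{j=1}^{m}\Gamma(b_j+B_js)}{\prod_{i=n+1}^{p}\Gamma(a_i+A_is)\prod_{j=m+1}^{q}\Gamma(1-b_j-B_js)},$$ where the line $\operatorname{Re}s=c$ avoids the singularities of the numerator Gamma factors, has those of $\Gamma(b_j+B_js)$, $j\le m$, on its left and those of $\Gamma(1-a_i-A_is)$, $i\le n$, on its right; points at which $\chi$ itself has only a removable singularity may lie on either side. A $\beta$-stable subordinator $D_\beta$, $0<\beta<1$, is a subordinator (a Lévy process with non-decreasing paths) with zero drift and Lévy measure $\frac{\beta}{\Gamma(1-\beta)x^{1+\beta}}\,dx$ on $(0,\infty)$,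 that is, $\mathbb E e^{-sD_\beta(t)}=\exp\left(-t\int_0^\infty(1-e^{-sx})\frac{\beta}{\Gamma(1-\beta)x^{1+\beta}}\,dx\right)$ for $s>0$. Let $n\ge1$, let $D_{\beta_1},\dots,D_{\beta_n}$ be independent $\beta_i$-stable subordinators, $0<\beta_i<1$, on a probability space, and let $t>0$. Then each $H$-function below is well defined on $(0,\infty)$ (an admissible line exists, and along every admissible line the integral converges absolutely to the same value), the random variables below have laws concentrated on $(0,\infty)$, and their probability densities there are as follows. (i) $aD_{\beta_i}(t)$, $a>0$, $1\le i\le n$: $$f(x,t)=\frac1{a\beta_it^{1/\beta_i}}H^{0,1}_{1,1}\left[\frac{x}{at^{1/\beta_i}}\,\middle|\,\begin{matrix}(1-1/\beta_i,1/\beta_i)\\(0,1)\end{matrix}\right],\quad x>0.$$ (ii) $\prod_{i=1}^nD_{\beta_i}(t)$: $$f(y,t)=\left(\prod_{i=1}^n\frac1{\beta_it^{1/\beta_i}}\right)H^{0,n}_{n,n}\left[\frac{y}{t^{\sum_{i=1}^n1/\beta_i}}\,\middle|\,\begin{matrix}(1-1/\beta_i,1/\beta_i)_{1,n}\\(0,1)_{1,n}\end{matrix}\right],\quad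 y>0.$$ (iii) $D_{\beta_i}^r(t)$, $1\le i\le n$, $r\ne0$ rational: for $r>0$ $$f(w,t)=\frac1{\beta_it^{r/\beta_i}}H^{0,1}_{1,1}\left[\frac{w}{t^{r/\beta_i}}\,\middle|\,\begin{matrix}(1-r/\beta_i,r/\beta_i)\\(1-r,r)\end{matrix}\right],\quad w>0,$$ and for $r<0$ $$f(w,t)=\frac1{\beta_it^{r/\beta_i}}H^{1,0}_{1,1}\left[\frac{w}{t^{r/\beta_i}}\,\middle|\,\begin{matrix}(r,-r)\\(r/\beta_i,-r/\beta_i)\end{matrix}\right],\quad w>0.$$ (iv) $D_{\beta_i}(t)/D_{\beta_j}(t)$, $1\le i,j\le n$, $i\ne j$: $$f(z,t)=\frac1{\beta_i\beta_jt^{1/\beta_i-1/\beta_j}}H^{1,1}_{2,2}\left[\frac{z}{t^{1/\beta_i-1/\beta_j}}\,\middle|\,\begin{matrix}(1-1/\beta_i,1/\beta_i)&(-1,1)\\(-1/\beta_j,1/\beta_j)&(0,1)\end{matrix}\right],\quad z>0.$$ -/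

import Mathlib

open MeasureTheory ProbabilityTheory Filter Topology
open scoped NNReal ENNReal

noncomputable section

/-- The Mellin–Barnes kernel of the Fox function `H^{m,n}_{p,q}` with upper parameters
`u i = (a_i, A_i)` and lower parameters `l j = (b_j, B_j)`:
`∏_{i ≤ n} Γ(1 - a_i - A_i s) ∏_{j ≤ m} Γ(b_j + B_j s) /
  (∏_{i > n} Γ(a_i + A_i s) ∏_{j > m} Γ(1 - b_j - B_j s))`.
(Indices start at `0` here. `Complex.Gamma` is `0` at the poles of `Γ`, so that
`(Complex.Gamma _)⁻¹` is the entire function `1 / Γ`.) -/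
def foxKernel (m n : ℕ) {p q : ℕ} (u : Fin p → ℂ × ℝ) (l : Fin q → ℂ × ℝ) (s : ℂ) : ℂ :=
  (∏ i : Fin p, if i.val < n then Complex.Gamma (1 - (u i).1 - (u i).2 * s)
    else (Complex.Gamma ((u i).1 + (u i).2 * s))⁻¹) *
  (∏ j : Fin q, if j.val < m then Complex.Gamma ((l j).1 + (l j).2 * s)
    else (Complex.Gamma (1 - (l j).1 - (l j).2 * s))⁻¹)

/-- The singularities of the factors `Γ(b_j + B_j s)`, `j ≤ m`. -/
def foxLeftPoles (m : ℕ) {q : ℕ} (l : Fin q → ℂ × ℝ) : Set ℂ :=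
  {s | ∃ j : Fin q, j.val < m ∧ ∃ k : ℕ, (l j).1 + (l j).2 * s = -(k : ℂ)}

/-- The singularities of the factors `Γ(1 - a_i - A_i s)`, `i ≤ n`. -/
def foxRightPoles (n : ℕ) {p : ℕ} (u : Fin p → ℂ × ℝ) : Set ℂ :=
  {s | ∃ i : Fin p, i.val < n ∧ ∃ k : ℕ, 1 - (u i).1 - (u i).2 * s = -(k : ℂ)}

/-- `s` is a genuine (non-removable) singularity of `f`. -/
def IsGenuineSingularity (f : ℂ → ℂ) (s : ℂ) : Prop :=
  ¬ ∃ w : ℂ, Tendsto f (𝓝[≠] s) (𝓝 w)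

/-- The vertical line `Re s = c` is an admissible path of integration: it meets no singularity
of a numerator Gamma factor, those of the factors `Γ(b_j + B_j s)` lie to its left and those of
the factors `Γ(1 - a_i - A_i s)` lie to its right. A point at which the singularities of the
numerator are cancelled by zeros of the reciprocal Gamma factors, so that the kernel itself has
only a removable singularity, may lie on either side. -/
structure IsFoxContour (m n : ℕ) {p q : ℕ} (u : Fin p → ℂ × ℝ) (l : Fin q → ℂ × ℝ)
    (c : ℝ) : Prop where
  avoids_left : ∀ s ∈ foxLeftPoles m l, s.re ≠ c
  avoids_right : ∀ s ∈ foxRightPoles n u, s.re ≠ c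
  left : ∀ s ∈ foxLeftPoles m l, IsGenuineSingularity (foxKernel m n u l) s → s.re < c
  right : ∀ s ∈ foxRightPoles n u, IsGenuineSingularity (foxKernel m n u l) s → c < s.re

/-- A line that separates all singularities of the numerator Gamma factors is admissible. -/
theorem IsFoxContour.of_separates {m n p q : ℕ} {u : Fin p → ℂ × ℝ} {l : Fin q → ℂ × ℝ} {c : ℝ}
    (hl : ∀ s ∈ foxLeftPoles m l, s.re < c) (hr : ∀ s ∈ foxRightPoles n u, c < s.re) :
    IsFoxContour m n u l c :=
  ⟨fun s hs => (hl s hs).ne, fun s hs => (hr s hs).ne', fun s hs _ => hl s hs,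
    fun s hs _ => hr s hs⟩

open Classical in
/-- The Fox function `H^{m,n}_{p,q}[z | u; l]` at a positive real argument `z`:
`(1 / 2πi) ∫_{c - i∞}^{c + i∞} χ(s) z^{-s} ds` along an admissible line. (With `s = c + i y`, this
is `mellinInv c χ z`.) That it exists and does not depend on `c` is `FoxHExists`. -/
def foxH (m n : ℕ) {p q : ℕ} (u : Fin p → ℂ × ℝ) (l : Fin q → ℂ × ℝ) (z : ℝ) : ℂ :=
  if h : ∃ c : ℝ, IsFoxContour m n u l c then mellinInv h.choose (foxKernel m n u l) z else 0

/-- The function `H^{m,n}_{p,q}[· | u; l]` is well defined on `(0, ∞)`: the orders and parameters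
are legitimate, there is an admissible line, and along every admissible line the integral converges
absolutely (for `z > 0` the modulus of `z^{-s}` is constant on the line) to the same value. -/
structure FoxHExists (m n : ℕ) {p q : ℕ} (u : Fin p → ℂ × ℝ) (l : Fin q → ℂ × ℝ) : Prop where
  m_le : m ≤ q
  n_le : n ≤ p
  upper_pos : ∀ i, 0 < (u i).2
  lower_pos : ∀ j, 0 < (l j).2
  exists_contour : ∃ c : ℝ, IsFoxContour m n u l c
  integrable : ∀ c : ℝ, IsFoxContour m n u l c →
    Complex.VerticalIntegrable (foxKernel m n u l) c
  eq_integral : ∀ c : ℝ, IsFoxContour m n u l c → ∀ z : ℝ, 0 < z →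
    foxH m n u l z = mellinInv c (foxKernel m n u l) z

/-- The random variable `X` has the probability density `f` on `(0, ∞)`, and density `0` on
`(-∞, 0]`. Part of the assertion is that `f` is real and nonnegative on `(0, ∞)`. -/
def HasPositiveDensity {Ω : Type*} [MeasurableSpace Ω] (X : Ω → ℝ) (P : Measure Ω)
    (f : ℝ → ℂ) : Prop :=
  AEMeasurable X P ∧ ∃ g : ℝ → ℝ, Measurable g ∧ (∀ x ≤ 0, g x = 0) ∧
    (∀ x, 0 < x → 0 ≤ g x ∧ (g x : ℂ) = f x) ∧
    P.map X = volume.withDensity (fun x => ENNReal.ofReal (g x))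

/-- `D` is a subordinator with drift `b` and Lévy measure `ν`: a Lévy process with non-decreasing
sample paths such that `E exp(-s D(t)) = exp(-t (b s + ∫ (1 - e^{-s x}) ν(dx)))`. -/
structure IsSubordinator {Ω : Type*} [MeasurableSpace Ω] (D : ℝ≥0 → Ω → ℝ) (P : Measure Ω)
    (b : ℝ) (ν : Measure ℝ) : Prop where
  drift_nonneg : 0 ≤ b
  levy_support : ν (Set.Iic 0) = 0
  levy_integrable : ∫⁻ x, ENNReal.ofReal (min x 1) ∂ν < ∞
  measurable : ∀ t, Measurable (D t)
  zero : ∀ᵐ ω ∂P, D 0 ω = 0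
  indep_increments : HasIndepIncrements D P
  stationary : ∀ s t : ℝ≥0, IdentDistrib (fun ω => D (s + t) ω - D s ω) (D t) P P
  monotone : ∀ᵐ ω ∂P, Monotone (fun t => D t ω)
  right_continuous : ∀ᵐ ω ∂P, ∀ t, ContinuousWithinAt (fun r => D r ω) (Set.Ici t) t
  laplace : ∀ (t : ℝ≥0) (s : ℝ), 0 < s →
    ∫ ω, Real.exp (-s * D t ω) ∂P =
      Real.exp (-t * (b * s + ∫ x, (1 - Real.exp (-s * x)) ∂ν))

/-- The Lévy measure `β / (Γ(1 - β) x^{1 + β}) dx` on `(0, ∞)`. -/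
def stableLevyMeasure (β : ℝ) : Measure ℝ :=
  (volume.restrict (Set.Ioi 0)).withDensity
    (fun x => ENNReal.ofReal (β / (Real.Gamma (1 - β) * x ^ (1 + β))))

/-- A `β`-stable subordinator: zero drift and Lévy measure `β / (Γ(1 - β) x^{1 + β}) dx`. -/
def IsStableSubordinator {Ω : Type*} [MeasurableSpace Ω] (D : ℝ≥0 → Ω → ℝ) (P : Measure Ω)
    (β : ℝ) : Prop :=
  IsSubordinator D P 0 (stableLevyMeasure β)

end

/-! Let `X` be nonnegative with Laplace transform `exp(-τ s^β)`. Integrating this transform against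
`s^(w-1)` gives `E X^(-w) = τ^(-w/β) β⁻¹ Γ(w/β)/Γ(w)` for real `w > 0`. Moments of order `v < β` are
finite, so the identity theorem extends the formula to complex `w ≠ 0` with `Re w > -β`
(`IsPositiveStable.complexMGF_log`). For independent `X_i` and `Y = ∏ X_i^(ρ_i)`, the Mellin
transform `E Y^(s-1)` is therefore `K b^s` times the product of the ratios
`Γ(ρ_i(1-s)/β_i)/Γ(ρ_i(1-s))`, which is the kernel of the Fox function sought. All cases are of this
form: scalar multiples and powers have one factor, products have every `ρ_i = 1`, quotients have `ρ
= (1, -1)`.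

Each ratio decays exponentially on vertical lines because `β_i < 1` (`exists_norm_Gamma_ratio_le`),
so Mellin inversion recovers the density of `Y` (`exists_density_eq_mellinInv`).

The singularity at `s = 1` is removable, while those at `ρ_i(1-s) = -β_i` are genuine. Admissible
lines are thus exactly the lines other than `Re s = 1` on which the moments of all factors are known
to be finite. No contour is shifted: the integrals along two admissible lines agree because both
give continuous densities of the same law. -/

/-! ### Fourier inversion for finite measures -/

section FourierInversion

open FourierTransform SchwartzMap
open scoped ContDiff

/-- The Fourier transform of a finite measure on `ℝ`, normalised by `e^{-2πi x ξ}`. -/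
noncomputable def MeasureTheory.Measure.fourier (ν : Measure ℝ) (ξ : ℝ) : ℂ :=
  VectorFourier.fourierIntegral Real.fourierChar ν (innerₗ ℝ) (fun _ => (1 : ℂ)) ξ

theorem MeasureTheory.Measure.fourier_apply (ν : Measure ℝ) (ξ : ℝ) :
    ν.fourier ξ = ∫ x, Complex.exp ((-2 * Real.pi * ξ * x : ℝ) * Complex.I) ∂ν := by
  simp only [Measure.fourier, VectorFourier.fourierIntegral, Circle.smul_def,
    Real.fourierChar_apply, smul_eq_mul, mul_one, innerₗ_apply_apply]
  refine integral_congr_ae (ae_of_all _ fun x => ?_)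
  simp only [RCLike.inner_apply, conj_trivial]
  congr 3
  ring

theorem MeasureTheory.Measure.charFun_eq_fourier (ν : Measure ℝ) (y : ℝ) :
    charFun ν y = ν.fourier (-(2 * Real.pi)⁻¹ * y) := by
  rw [charFun_apply_real, Measure.fourier_apply]
  refine integral_congr_ae (ae_of_all _ fun x => ?_)
  simp only
  congr 2
  rw [← Complex.ofReal_mul]
  congr 1
  field_simp

theorem MeasureTheory.Measure.continuous_fourier (ν : Measure ℝ) [IsFiniteMeasure ν] :
    Continuous ν.fourier :=
  VectorFourier.fourierIntegral_continuous Real.continuous_fourierChar continuous_inner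
    (integrable_const 1)

theorem continuous_fourierInv {F : ℝ → ℂ} (hF : Integrable F) : Continuous (𝓕⁻ F) := by
  have : (𝓕⁻ F) = fun x => 𝓕 F (-x) := funext fun x => Real.fourierInv_eq_fourier_neg F x
  rw [this]
  exact (VectorFourier.fourierIntegral_continuous Real.continuous_fourierChar continuous_inner
    hF).comp continuous_neg

/-- Duality between the inverse Fourier transform of `ν.fourier` and `ν`, against Schwartz
functions. -/
theorem integral_fourierInv_measure_fourier_mul (ν : Measure ℝ) [IsFiniteMeasure ν]
    (hF : Integrable ν.fourier) (ψ : 𝓢(ℝ, ℂ)) :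
    ∫ x, 𝓕⁻ ν.fourier x * ψ x = ∫ x, ψ x ∂ν := by
  have h1 : ∫ ξ, ν.fourier ξ * (𝓕⁻ ψ) ξ = ∫ x, ψ x ∂ν := by
    have := VectorFourier.integral_fourierIntegral_smul_eq_flip (μ := ν) (ν := volume)
      (L := innerₗ ℝ) (f := fun _ => (1 : ℂ)) (g := (𝓕⁻ ψ : 𝓢(ℝ, ℂ)))
      Real.continuous_fourierChar continuous_inner (integrable_const 1) (𝓕⁻ ψ).integrable
    simp only [smul_eq_mul, one_mul, flip_innerₗ] at this
    refine this.trans (integral_congr_ae (ae_of_all _ fun x => ?_))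
    change 𝓕 ((𝓕⁻ ψ : 𝓢(ℝ, ℂ)) : ℝ → ℂ) x = ψ x
    rw [← fourier_coe, FourierTransform.fourier_fourierInv_eq]
  rw [← h1]
  -- Negating the pairing turns the forward transform into the inverse one, so the same
  -- self-adjointness identity applies.
  have h2 := VectorFourier.integral_fourierIntegral_smul_eq_flip (μ := volume) (ν := volume)
    (L := -innerₗ ℝ) (f := ν.fourier) (g := ψ)
    Real.continuous_fourierChar continuous_inner.neg hF ψ.integrable
  have h3 : (-innerₗ ℝ : ℝ →ₗ[ℝ] ℝ →ₗ[ℝ] ℝ).flip = -innerₗ ℝ := by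
    ext; simp
  rw [h3] at h2
  rw [fourierInv_coe]
  exact h2

/-- A continuous function whose integral against nonnegative bump functions is nonnegative is
nonnegative. -/
theorem nonneg_of_integral_contDiffBump_nonneg {h : ℝ → ℝ} (hc : Continuous h)
    (hpos : ∀ ψ : ℝ → ℝ, ContDiff ℝ ∞ ψ → HasCompactSupport ψ → (∀ x, 0 ≤ ψ x) →
      0 ≤ ∫ x, h x * ψ x) (x₀ : ℝ) : 0 ≤ h x₀ := by
  -- An approximate identity: normalised bumps whose supports shrink to `0`.
  let φ : ℕ → ContDiffBump (0 : ℝ) := fun n =>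
    ⟨1 / (2 * (n + 1)), 1 / (n + 1), by positivity, by
      apply one_div_lt_one_div_of_lt <;> [positivity; linarith [n.cast_nonneg (α := ℝ)]]⟩
  have hφ : Tendsto (fun i => (φ i).rOut) atTop (𝓝 0) := tendsto_one_div_add_atTop_nhds_zero_nat
  have := ContDiffBump.convolution_tendsto_right_of_continuous (μ := volume) hφ hc x₀
  refine ge_of_tendsto' this fun n => ?_
  rw [convolution_eq_swap]
  have := hpos (fun t => (φ n).normed volume (x₀ - t)) ?_ ?_ ?_
  · refine this.trans_eq (integral_congr_ae (ae_of_all _ fun t => ?_))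
    simp [mul_comm]
  · exact (φ n).contDiff_normed.comp (contDiff_const.sub contDiff_id)
  · exact (φ n).hasCompactSupport_normed.comp_homeomorph (Homeomorph.subLeft x₀)
  · exact fun t => (φ n).nonneg_normed _

theorem integral_fourierInv_mul_of_contDiff (ν : Measure ℝ) [IsFiniteMeasure ν]
    (hF : Integrable ν.fourier) {ψ : ℝ → ℝ} (h1 : ContDiff ℝ ∞ ψ) (h2 : HasCompactSupport ψ) :
    ∫ x, 𝓕⁻ ν.fourier x * ψ x = ((∫ x, ψ x ∂ν : ℝ) : ℂ) := by
  have h3 : HasCompactSupport (fun x => (ψ x : ℂ)) := h2.comp_left (g := Complex.ofReal) rfl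
  have h4 : ContDiff ℝ ∞ (fun x => (ψ x : ℂ)) := Complex.ofRealCLM.contDiff.comp h1
  have := integral_fourierInv_measure_fourier_mul ν hF (h3.toSchwartzMap h4)
  rw [← integral_complex_ofReal]
  exact this

theorem integrable_continuous_mul_of_hasCompactSupport {h : ℝ → ℂ} (hc : Continuous h) {ψ : ℝ → ℝ}
    (h1 : Continuous ψ) (h2 : HasCompactSupport ψ) : Integrable (fun x => h x * ψ x) := by
  apply Continuous.integrable_of_hasCompactSupport (by fun_prop)
  exact (h2.comp_left (g := Complex.ofReal) rfl).mul_left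

/-- A finite measure on `ℝ` with integrable Fourier transform has as density the inverse Fourier
transform of its Fourier transform. -/
theorem eq_withDensity_fourierInv (ν : Measure ℝ) [IsFiniteMeasure ν]
    (hF : Integrable ν.fourier) :
    ∃ h : ℝ → ℝ, Continuous h ∧ (∀ x, 0 ≤ h x) ∧ (∀ x, (h x : ℂ) = 𝓕⁻ ν.fourier x) ∧
      ν = volume.withDensity (fun x => ENNReal.ofReal (h x)) := by
  have hc := continuous_fourierInv hF
  have key := fun ψ h1 h2 => integral_fourierInv_mul_of_contDiff ν hF (ψ := ψ) h1 h2
  have hint := fun ψ h1 h2 => integrable_continuous_mul_of_hasCompactSupport hc (ψ := ψ) h1 h2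
  have hre : ∀ ψ : ℝ → ℝ, ContDiff ℝ ∞ ψ → HasCompactSupport ψ →
      ∫ x, (𝓕⁻ ν.fourier x).re * ψ x = ∫ x, ψ x ∂ν := by
    intro ψ h1 h2
    have := congrArg Complex.re (key ψ h1 h2)
    rw [Complex.ofReal_re, ← RCLike.re_eq_complex_re, ← integral_re (hint ψ h1.continuous h2)] at this
    simpa using this
  have him : ∀ ψ : ℝ → ℝ, ContDiff ℝ ∞ ψ → HasCompactSupport ψ →
      ∫ x, (𝓕⁻ ν.fourier x).im * ψ x = 0 := by
    intro ψ h1 h2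
    have := congrArg Complex.im (key ψ h1 h2)
    rw [Complex.ofReal_im, ← RCLike.im_eq_complex_im, ← integral_im (hint ψ h1.continuous h2)] at this
    simpa using this
  set h : ℝ → ℝ := fun x => (𝓕⁻ ν.fourier x).re with hh
  have hcr : Continuous h := Complex.continuous_re.comp hc
  have hci : Continuous fun x => (𝓕⁻ ν.fourier x).im := Complex.continuous_im.comp hc
  have h0 : ∀ x, 0 ≤ h x := nonneg_of_integral_contDiffBump_nonneg hcr fun ψ h1 h2 h3 => by
    rw [hre ψ h1 h2]
    exact integral_nonneg h3
  have h_eq : ∀ x, (h x : ℂ) = 𝓕⁻ ν.fourier x := by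
    intro x
    -- The imaginary part has zero integral against every test function, so both it and its negative
    -- are nonnegative.
    have i1 := nonneg_of_integral_contDiffBump_nonneg hci
      (fun ψ h1 h2 _ => (him ψ h1 h2).ge) x
    have i2 := nonneg_of_integral_contDiffBump_nonneg hci.neg
      (fun ψ h1 h2 _ => by simp [integral_neg, him ψ h1 h2]) x
    apply Complex.ext
    · simp [hh]
    · simp only [Complex.ofReal_im, Pi.neg_apply] at i2 ⊢
      linarith
  have h_int : Integrable h := by
    refine (aecover_closedBall (x := (0 : ℝ)) tendsto_id).integrable_of_integral_bounded_of_nonneg_ae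
      (l := atTop) (ν.real Set.univ)
      (fun i => hcr.locallyIntegrable.integrableOn_isCompact (isCompact_closedBall _ _))
      (ae_of_all _ h0) ?_
    filter_upwards [eventually_gt_atTop 0] with R hR
    -- A bump equal to `1` on the ball of radius `R` and at most `1` elsewhere bounds the mass of
    -- `h` there by that of `ν`.
    let ψ : ContDiffBump (0 : ℝ) := ⟨R, R + 1, hR, by linarith⟩
    have hψ : Integrable fun x => h x * ψ x :=
      (hcr.mul ψ.continuous).integrable_of_hasCompactSupport ψ.hasCompactSupport.mul_left
    calc ∫ x in Metric.closedBall 0 R, h x = ∫ x in Metric.closedBall 0 R, h x * ψ x := by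
          refine setIntegral_congr_fun Metric.isClosed_closedBall.measurableSet fun x hx => ?_
          simp [ψ.one_of_mem_closedBall hx]
      _ ≤ ∫ x, h x * ψ x :=
          setIntegral_le_integral hψ (ae_of_all _ fun x => mul_nonneg (h0 x) ψ.nonneg)
      _ = ∫ x, ψ x ∂ν := hre ψ ψ.contDiff ψ.hasCompactSupport
      _ ≤ ∫ _, 1 ∂ν := by
          refine integral_mono_of_nonneg (ae_of_all _ fun x => ψ.nonneg) (integrable_const _)
            (ae_of_all _ fun x => ψ.le_one)
      _ = ν.real Set.univ := by simp
  refine ⟨h, hcr, h0, h_eq, ?_⟩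
  have : IsFiniteMeasure (volume.withDensity fun x => ENNReal.ofReal (h x)) :=
    isFiniteMeasure_withDensity_ofReal h_int.2
  apply Measure.ext_of_charFun
  ext y
  rw [Measure.charFun_eq_fourier, Measure.charFun_eq_fourier]
  generalize -(2 * Real.pi)⁻¹ * y = ξ
  have hcF := ν.continuous_fourier
  have hi : Integrable (𝓕⁻ ν.fourier) := by
    have : 𝓕⁻ ν.fourier = fun x => (h x : ℂ) := funext fun x => (h_eq x).symm
    rw [this]
    exact h_int.ofReal
  -- Classical inversion needs both `ν.fourier` and its transform integrable; the second is what
  -- `h_int` provides.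
  have inv : 𝓕 (𝓕⁻ ν.fourier) ξ = ν.fourier ξ := by
    rw [hcF.fourier_fourierInv_eq hF]
    have : 𝓕 ν.fourier = fun x => 𝓕⁻ ν.fourier (-x) := by
      ext x
      rw [Real.fourierInv_eq_fourier_neg, neg_neg]
    rw [this]
    exact hi.comp_neg
  rw [← inv, Measure.fourier_apply]
  rw [integral_withDensity_eq_integral_toReal_smul (by fun_prop) (by simp), Real.fourier_eq']
  refine integral_congr_ae (ae_of_all _ fun x => ?_)
  simp only [ENNReal.toReal_ofReal (h0 x), ← h_eq x, Complex.real_smul, smul_eq_mul]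
  rw [mul_comm]
  congr 3
  simp
  ring

end FourierInversion

/-! ### Mellin inversion for positive random variables -/

section MellinInversion

variable {Ω : Type*} [MeasurableSpace Ω]

/-- A positive random variable whose Mellin transform is integrable on a vertical line has as
density the inverse Mellin transform of its Mellin transform. -/
theorem exists_density_eq_mellinInv (P : Measure Ω) [IsFiniteMeasure P] {X : Ω → ℝ}
    (hX : AEMeasurable X P) (hpos : ∀ᵐ ω ∂P, 0 < X ω) {c : ℝ}
    (hint : Integrable (fun ω => Real.exp ((c - 1) * Real.log (X ω))) P)
    (hM : Integrable fun y : ℝ =>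
      complexMGF (fun ω => Real.log (X ω)) P ((c : ℂ) + y * Complex.I - 1)) :
    ∃ g : ℝ → ℝ, Measurable g ∧ ContinuousOn g (Set.Ioi 0) ∧ (∀ x ≤ 0, g x = 0) ∧
      (∀ x, 0 < x → 0 ≤ g x ∧ (g x : ℂ) =
        mellinInv c (fun s => complexMGF (fun ω => Real.log (X ω)) P (s - 1)) x) ∧
      P.map X = volume.withDensity (fun x => ENNReal.ofReal (g x)) := by
  -- Tilting `P` by `X^(c-1)` turns the Mellin transform on `Re s = c` into the Fourier transform of
  -- the law `ν` of `-log X`.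
  set w : Ω → ℝ := fun ω => Real.exp ((c - 1) * Real.log (X ω)) with hw
  have hlog : AEMeasurable (fun ω => Real.log (X ω)) P := hX.log
  have hwm : AEMeasurable w P := (hlog.const_mul _).exp
  set Q := P.withDensity fun ω => ENNReal.ofReal (w ω) with hQ
  have hQP : Q ≪ P := withDensity_absolutelyContinuous _ _
  have : IsFiniteMeasure Q := isFiniteMeasure_withDensity_ofReal hint.2
  set ν := Q.map fun ω => -Real.log (X ω) with hν
  have hlogQ : AEMeasurable (fun ω => -Real.log (X ω)) Q := hlog.neg.mono_ac hQP
  have hfour : ∀ ξ, ν.fourier ξ = complexMGF (fun ω => Real.log (X ω)) P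
      ((c : ℂ) + (2 * Real.pi * ξ : ℝ) * Complex.I - 1) := by
    intro ξ
    rw [Measure.fourier_apply, hν, integral_map hlogQ (by fun_prop), hQ,
      integral_withDensity_eq_integral_toReal_smul₀ (by fun_prop) (by simp)]
    rw [complexMGF]
    refine integral_congr_ae (ae_of_all _ fun ω => ?_)
    simp only [hw, ENNReal.toReal_ofReal (Real.exp_pos _).le, Complex.real_smul, Complex.ofReal_exp]
    rw [← Complex.exp_add]
    congr 1
    push_cast
    ring
  have hF : Integrable ν.fourier := by
    have := hM.comp_mul_left' (R := 2 * Real.pi) (by positivity)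
    refine this.congr (ae_of_all _ fun ξ => ?_)
    simp only [hfour]
  obtain ⟨h, hc, h0, h_eq, hνh⟩ := eq_withDensity_fourierInv ν hF
  -- The factor `x^(-c)` combines the Jacobian `1/x` of `u = -log x` with the inverse `x^(1-c)` of
  -- the tilt.
  refine ⟨fun x => if 0 < x then x ^ (-c) * h (-Real.log x) else 0, ?_, ?_, ?_, ?_, ?_⟩
  · refine Measurable.ite measurableSet_Ioi ?_ measurable_const
    exact (measurable_id.pow_const _).mul (hc.measurable.comp Real.measurable_log.neg)
  · have : ContinuousOn (fun x : ℝ => x ^ (-c) * h (-Real.log x)) (Set.Ioi 0) := by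
      refine ContinuousOn.mul ?_ ?_
      · exact fun x hx => (Real.continuousAt_rpow_const _ _ (.inl (ne_of_gt hx))).continuousWithinAt
      · refine hc.comp_continuousOn ?_
        exact fun x hx => (Real.continuousAt_log (ne_of_gt hx)).neg.continuousWithinAt
    exact this.congr fun x hx => if_pos hx
  · exact fun x hx => if_neg hx.not_gt
  · intro x hx
    simp only [hx, if_true]
    refine ⟨mul_nonneg (Real.rpow_nonneg hx.le _) (h0 _), ?_⟩
    rw [mellinInv_eq_fourierInv _ _ hx, Complex.ofReal_mul, h_eq, smul_eq_mul,
      Complex.ofReal_cpow hx.le, Complex.ofReal_neg]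
    have : ν.fourier = fun y : ℝ => complexMGF (fun ω => Real.log (X ω)) P
        ((c : ℂ) + 2 * Real.pi * y * Complex.I - 1) := by
      funext ξ
      rw [hfour]
      push_cast
      rfl
    rw [this]
  · ext A hA
    rw [Measure.map_apply_of_aemeasurable hX hA, withDensity_apply _ hA]
    -- The exponential removes the tilt: at `u = -log X` it equals `X^(1-c)`.
    set φ : ℝ → ℝ≥0∞ := fun u =>
      A.indicator 1 (Real.exp (-u)) * ENNReal.ofReal (Real.exp ((c - 1) * u)) with hφ
    have hm : Measurable φ :=
      ((measurable_one.indicator hA).comp (by fun_prop)).mul (by fun_prop)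
    have hφQ : AEMeasurable (fun ω => φ (-Real.log (X ω))) P := hm.comp_aemeasurable hlog.neg
    have hwQ : AEMeasurable (fun ω => ENNReal.ofReal (w ω)) P := hwm.ennreal_ofReal
    have e1 : P (X ⁻¹' A) = ∫⁻ u, φ u ∂ν := by
      rw [hν, lintegral_map' hm.aemeasurable hlogQ, hQ,
        lintegral_withDensity_eq_lintegral_mul₀ hwQ hφQ, ← lintegral_indicator_one₀ (hX.nullMeasurableSet_preimage hA)]
      refine lintegral_congr_ae ?_
      filter_upwards [hpos] with ω hω
      simp only [Pi.mul_apply, hφ, neg_neg, Real.exp_log hω, hw]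
      rw [mul_left_comm, ← ENNReal.ofReal_mul (Real.exp_pos _).le, ← Real.exp_add]
      simp [Set.indicator, Set.mem_preimage]
      rfl
    rw [e1, hνh, lintegral_withDensity_eq_lintegral_mul _
      (hc.measurable.ennreal_ofReal) hm]
    have himg : (fun u : ℝ => Real.exp (-u)) '' Set.univ = Set.Ioi 0 := by
      ext x
      constructor
      · rintro ⟨u, -, rfl⟩
        exact Real.exp_pos _
      · exact fun hx => ⟨-Real.log x, trivial, by simp [Real.exp_log hx]⟩
    have e2 : ∫⁻ x in A, ENNReal.ofReal (if 0 < x then x ^ (-c) * h (-Real.log x) else 0) =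
        ∫⁻ x in Set.Ioi 0, A.indicator 1 x * ENNReal.ofReal (x ^ (-c) * h (-Real.log x)) := by
      rw [← lintegral_indicator hA, ← lintegral_indicator measurableSet_Ioi]
      refine lintegral_congr fun x => ?_
      by_cases h1 : x ∈ A <;> by_cases h2 : 0 < x <;> simp [h1, h2]
    rw [e2, ← himg, lintegral_image_eq_lintegral_abs_deriv_mul (f' := fun u => -Real.exp (-u))
      MeasurableSet.univ
      (fun u _ => by simpa using! ((hasDerivAt_id u).neg).exp)
      (fun a _ b _ hab => by simpa using hab), setLIntegral_univ]
    refine lintegral_congr fun u => ?_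
    simp only [Pi.mul_apply, hφ, abs_neg, abs_of_pos (Real.exp_pos _), Real.log_exp, neg_neg]
    rw [mul_left_comm (ENNReal.ofReal (h u)), mul_left_comm (ENNReal.ofReal (Real.exp _)),
      ← ENNReal.ofReal_mul (h0 u), ← ENNReal.ofReal_mul (Real.exp_pos _).le, ← Real.exp_mul, ← mul_assoc, ← Real.exp_add,
      mul_comm (h u)]
    congr 4
    ring

end MellinInversion

/-! ### Decay of the Gamma function on vertical lines -/

section GammaDecay

open Complex (I)

theorem Complex.norm_sin_le_exp_abs_im (z : ℂ) : ‖Complex.sin z‖ ≤ Real.exp |z.im| := by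
  have h1 : ‖Complex.exp (-z * I)‖ ≤ Real.exp |z.im| := by
    rw [Complex.norm_exp]
    simpa using le_abs_self z.im
  have h2 : ‖Complex.exp (z * I)‖ ≤ Real.exp |z.im| := by
    rw [Complex.norm_exp]
    simpa using neg_le_abs z.im
  calc ‖Complex.sin z‖ = ‖Complex.exp (-z * I) - Complex.exp (z * I)‖ / 2 := by
        simp [Complex.sin]
    _ ≤ (‖Complex.exp (-z * I)‖ + ‖Complex.exp (z * I)‖) / 2 := by
        gcongr; exact norm_sub_le _ _
    _ ≤ Real.exp |z.im| := by linarith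

/-- `Γ` decays faster than `exp (-θ |Im s|)`, `θ < π / 2`, on the line `Re s = a`. -/
def GammaDecays (a : ℝ) : Prop :=
  ∀ θ < Real.pi / 2, ∃ C, 0 ≤ C ∧ ∀ s : ℂ, s.re = a → 1 ≤ |s.im| →
    ‖Complex.Gamma s‖ ≤ C * Real.exp (-θ * |s.im|)

/-- On this line `1 - s` is the conjugate of `s`, so the reflection formula gives the exact value
`|Γ(s)|² = π / cosh(π Im s)`. -/
theorem gammaDecays_one_half : GammaDecays (1 / 2) := by
  intro θ hθ
  refine ⟨√(2 * Real.pi), by positivity, fun s hs _ => ?_⟩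
  have h1 : 1 - s = (starRingEnd ℂ) s := by
    apply Complex.ext <;> simp [hs]; norm_num
  have h2 := Complex.Gamma_mul_Gamma_one_sub s
  rw [h1, Complex.Gamma_conj, Complex.mul_conj'] at h2
  have h3 : Complex.sin (Real.pi * s) = Real.cosh (Real.pi * s.im) := by
    have : (Real.pi : ℂ) * s = Real.pi / 2 - -((Real.pi * s.im : ℝ) : ℂ) * I := by
      conv_lhs => rw [← Complex.re_add_im s, hs]
      push_cast
      ring
    rw [this, Complex.sin_pi_div_two_sub, Complex.cos_mul_I, Complex.cosh_neg, Complex.ofReal_cosh]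
  rw [h3] at h2
  have h4 : ‖Complex.Gamma s‖ ^ 2 = Real.pi / Real.cosh (Real.pi * s.im) := by exact_mod_cast h2
  have h5 : Real.exp (Real.pi * |s.im|) / 2 ≤ Real.cosh (Real.pi * s.im) := by
    rw [← Real.cosh_abs, abs_mul, abs_of_pos Real.pi_pos, Real.cosh_eq]
    have := Real.exp_pos (-(Real.pi * |s.im|))
    linarith
  have h6 : ‖Complex.Gamma s‖ ^ 2 ≤ (√(2 * Real.pi) * Real.exp (-θ * |s.im|)) ^ 2 := by
    rw [h4, mul_pow, Real.sq_sqrt (by positivity), ← Real.exp_nat_mul]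
    calc Real.pi / Real.cosh (Real.pi * s.im) ≤ Real.pi / (Real.exp (Real.pi * |s.im|) / 2) := by
          gcongr
      _ = 2 * Real.pi * Real.exp (-(Real.pi * |s.im|)) := by
          rw [Real.exp_neg]
          field_simp
      _ ≤ _ := by
          gcongr
          push_cast
          nlinarith [abs_nonneg s.im]
  exact le_of_sq_le_sq h6 (by positivity)

/-- The functional equation costs a factor linear in `|Im s|`, absorbed by starting from an exponent
`θ'` strictly between `θ` and `π/2`. -/
theorem GammaDecays.add_one {a : ℝ} (h : GammaDecays a) : GammaDecays (a + 1) := by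
  intro θ hθ
  obtain ⟨θ', h1, h2⟩ := exists_between hθ
  obtain ⟨C, hC, hb⟩ := h θ' h2
  have hd : 0 < θ' - θ := sub_pos.2 h1
  refine ⟨(|a| + 1) * (1 / (θ' - θ)) * C + |a| * C , by positivity, fun s hs him => ?_⟩
  have hs0 : s - 1 ≠ 0 := by
    intro h0
    have := congrArg Complex.im h0
    simp at this
    rw [this] at him
    norm_num at him
  have e1 : Complex.Gamma s = (s - 1) * Complex.Gamma (s - 1) := by
    rw [← Complex.Gamma_add_one _ hs0, sub_add_cancel]
  have e2 := hb (s - 1) (by simp [hs]) (by simpa using him)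
  have e3 : ‖s - 1‖ ≤ |a| + |s.im| := by
    have := Complex.norm_le_abs_re_add_abs_im (s - 1)
    simpa [hs] using this
  have e4 : |s.im| ≤ 1 / (θ' - θ) * Real.exp ((θ' - θ) * |s.im|) := by
    rw [div_mul_eq_mul_div, one_mul, le_div_iff₀ hd]
    have := Real.add_one_le_exp ((θ' - θ) * |s.im|)
    linarith
  have e5 : (1 : ℝ) ≤ Real.exp ((θ' - θ) * |s.im|) := Real.one_le_exp (by positivity)
  simp only [Complex.sub_im, Complex.one_im, sub_zero] at e2
  rw [e1, norm_mul]
  calc ‖s - 1‖ * ‖Complex.Gamma (s - 1)‖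
      ≤ (|a| + |s.im|) * (C * Real.exp (-θ' * |s.im|)) := by gcongr
    _ ≤ (|a| * Real.exp ((θ' - θ) * |s.im|) + 1 / (θ' - θ) * Real.exp ((θ' - θ) * |s.im|)) *
        (C * Real.exp (-θ' * |s.im|)) := by
        gcongr
        nlinarith [abs_nonneg a]
    _ = (|a| + 1 / (θ' - θ)) * C * Real.exp (-θ * |s.im|) := by
        have : Real.exp (-θ * |s.im|) =
            Real.exp ((θ' - θ) * |s.im|) * Real.exp (-θ' * |s.im|) := by
          rw [← Real.exp_add]; ring_nf
        rw [this]
        ring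
    _ ≤ _ := by
        gcongr
        have : 0 ≤ |a| * (1 / (θ' - θ)) * C := by positivity
        linarith

theorem GammaDecays.of_add_one {a : ℝ} (h : GammaDecays (a + 1)) : GammaDecays a := by
  intro θ hθ
  obtain ⟨C, hC, hb⟩ := h θ hθ
  refine ⟨C, hC, fun s hs him => ?_⟩
  have hn : 1 ≤ ‖s‖ := him.trans (Complex.abs_im_le_norm s)
  have hs0 : s ≠ 0 := norm_pos_iff.1 (by linarith)
  have e2 := hb (s + 1) (by simp [hs]) (by simpa using him)
  rw [Complex.Gamma_add_one _ hs0, norm_mul] at e2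
  simp only [Complex.add_im, Complex.one_im, add_zero] at e2
  exact (le_mul_of_one_le_left (norm_nonneg _) hn).trans e2

theorem GammaDecays.add_nat {a : ℝ} (h : GammaDecays a) (n : ℕ) : GammaDecays (a + n) := by
  induction n with
  | zero => simpa using h
  | succ n ih => simpa [add_assoc] using ih.add_one

theorem GammaDecays.of_add_nat {a : ℝ} (n : ℕ) (h : GammaDecays (a + n)) : GammaDecays a := by
  induction n with
  | zero => simpa using h
  | succ n ih => exact ih (GammaDecays.of_add_one (by simpa [add_assoc] using h))

theorem Complex.norm_betaIntegral_le (u v : ℂ) :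
    ‖Complex.betaIntegral u v‖ ≤ ∫ x in (0 : ℝ)..1, x ^ (u.re - 1) * (1 - x) ^ (v.re - 1) := by
  rw [Complex.betaIntegral]
  refine (intervalIntegral.norm_integral_le_integral_norm zero_le_one).trans_eq ?_
  rw [intervalIntegral.integral_of_le zero_le_one, intervalIntegral.integral_of_le zero_le_one,
    integral_Ioc_eq_integral_Ioo, integral_Ioc_eq_integral_Ioo]
  refine setIntegral_congr_fun measurableSet_Ioo fun x hx => ?_
  have h1 : (1 : ℂ) - x = ((1 - x : ℝ) : ℂ) := by push_cast; rfl
  simp only [norm_mul]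
  rw [h1, Complex.norm_cpow_eq_rpow_re_of_pos hx.1,
    Complex.norm_cpow_eq_rpow_re_of_pos (sub_pos.2 hx.2)]
  simp

/-- Since `Γ(s) Γ(b-a) = Γ(s+b-a) B(s, b-a)` and the Beta integral is bounded on `Re s = a`, decay
passes from `b` to `a`. This reaches non-half-integer abscissae without Stirling's formula. -/
theorem GammaDecays.of_lt {a b : ℝ} (ha : 0 < a) (hab : a < b) (h : GammaDecays b) :
    GammaDecays a := by
  intro θ hθ
  obtain ⟨C, hC, hb⟩ := h θ hθ
  have hG : 0 < Real.Gamma (b - a) := Real.Gamma_pos_of_pos (sub_pos.2 hab)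
  set B := ∫ x in (0 : ℝ)..1, x ^ (a - 1) * (1 - x) ^ (b - a - 1) with hB
  refine ⟨C * |B| / Real.Gamma (b - a), by positivity, fun s hs him => ?_⟩
  have key := Complex.Gamma_mul_Gamma_eq_betaIntegral (s := s) (t := ((b - a : ℝ) : ℂ))
    (by rwa [hs]) (by simpa using hab)
  have e1 := hb (s + ((b - a : ℝ) : ℂ)) (by simp [hs]) (by simpa using him)
  have e2 := Complex.norm_betaIntegral_le s ((b - a : ℝ) : ℂ)
  rw [hs, Complex.ofReal_re, ← hB] at e2
  have e3 := congrArg norm key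
  rw [norm_mul, norm_mul, Complex.Gamma_ofReal, Complex.norm_real, Real.norm_of_nonneg hG.le] at e3
  rw [div_mul_eq_mul_div, le_div_iff₀ hG, e3]
  simp only [Complex.add_im, Complex.ofReal_im, add_zero] at e1
  calc _ ≤ (C * Real.exp (-θ * |s.im|)) * |B| := by
        gcongr
        exact e2.trans (le_abs_self _)
    _ = _ := by ring

theorem gammaDecays (a : ℝ) : GammaDecays a := by
  obtain ⟨n, hn⟩ := exists_nat_gt (-a)
  refine GammaDecays.of_add_nat n ?_
  obtain ⟨m, hm⟩ := exists_nat_gt (a + n)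
  exact GammaDecays.of_lt (by linarith) (by linarith) (gammaDecays_one_half.add_nat m)

theorem continuous_Gamma_ratio {a β : ℝ} (ha : ∀ k : ℕ, a / β ≠ -k) :
    Continuous fun y : ℝ => Complex.Gamma ((a + y * I) / β) * (Complex.Gamma (a + y * I))⁻¹ := by
  refine Continuous.mul ?_ ?_
  · refine continuous_iff_continuousAt.2 fun y => ?_
    refine ContinuousAt.comp (f := fun y : ℝ => ((a : ℂ) + y * I) / β)
      (Complex.differentiableAt_Gamma _ fun m hm => ?_).continuousAt (by fun_prop)
    apply ha m
    have := congrArg Complex.re hm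
    simpa [Complex.div_ofReal_re] using this
  · exact Complex.differentiable_one_div_Gamma.continuous.comp (by fun_prop)

/-- On a vertical line avoiding its poles, `Γ(w / β) / Γ(w)`, `0 < β < 1`, decays exponentially. -/
theorem exists_norm_Gamma_ratio_le {β : ℝ} (hβ0 : 0 < β) (hβ1 : β < 1) {a : ℝ}
    (ha : ∀ k : ℕ, a / β ≠ -k) :
    ∃ C δ : ℝ, 0 < δ ∧ ∀ w : ℂ, w.re = a →
      ‖Complex.Gamma (w / β) * (Complex.Gamma w)⁻¹‖ ≤ C * Real.exp (-δ * |w.im|) := by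
  -- By reflection `1/Γ(w) = Γ(1-w) sin(πw)/π`, so the decay rate is `θ/β + θ - π`. It is positive
  -- precisely above this lower bound, and `β < 1` leaves room below `π/2`.
  obtain ⟨θ, hθ1, hθ2⟩ : ∃ θ, Real.pi * β / (1 + β) < θ ∧ θ < Real.pi / 2 := by
    apply exists_between
    rw [div_lt_div_iff₀ (by linarith) two_pos]
    nlinarith [Real.pi_pos]
  have hδ : 0 < θ / β + θ - Real.pi := by
    rw [div_lt_iff₀ (by linarith)] at hθ1
    have : θ / β + θ - Real.pi = (θ * (1 + β) - Real.pi * β) / β := by field_simp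
    rw [this]
    exact div_pos (by linarith) hβ0
  set δ := θ / β + θ - Real.pi with hδd
  obtain ⟨C₁, hC₁, h₁⟩ := gammaDecays (a / β) θ hθ2
  obtain ⟨C₂, hC₂, h₂⟩ := gammaDecays (1 - a) θ hθ2
  have hcont := continuous_Gamma_ratio ha
  obtain ⟨C₃, h₃⟩ := (isCompact_Icc (a := (-1 : ℝ)) (b := 1)).exists_bound_of_continuousOn
    hcont.continuousOn
  have hC₃ : 0 ≤ C₃ := (norm_nonneg _).trans (h₃ 0 (by simp))
  refine ⟨C₁ * C₂ + C₃ * Real.exp δ, δ, hδ, fun w hw => ?_⟩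
  rcases le_total 1 |w.im| with hy | hy
  · have e1 := h₁ (w / β) (by rw [Complex.div_ofReal_re, hw]) (by
      rw [Complex.div_ofReal_im, abs_div, abs_of_pos hβ0, le_div_iff₀ hβ0]
      linarith)
    have e2 := h₂ (1 - w) (by simp [hw]) (by simpa using hy)
    have hsin : Complex.sin (Real.pi * w) ≠ 0 := by
      intro h
      obtain ⟨k, hk⟩ := Complex.sin_eq_zero_iff.1 h
      have := congrArg Complex.im hk
      simp [Real.pi_ne_zero] at this
      rw [this] at hy
      norm_num at hy
    have e3 : (Complex.Gamma w)⁻¹ =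
        Complex.Gamma (1 - w) * (Complex.sin (Real.pi * w) / Real.pi) := by
      have h := Complex.Gamma_mul_Gamma_one_sub w
      have hpi : (Real.pi : ℂ) ≠ 0 := by exact_mod_cast Real.pi_ne_zero
      have h0 : Complex.Gamma w ≠ 0 := by
        intro h0
        rw [h0, zero_mul] at h
        exact div_ne_zero hpi hsin h.symm
      rw [eq_comm, ← mul_right_inj' h0, ← mul_assoc, h, mul_inv_cancel₀ h0]
      field_simp
    have e4 : ‖Complex.sin (Real.pi * w) / Real.pi‖ ≤ Real.exp (Real.pi * |w.im|) := by
      rw [norm_div, Complex.norm_real, Real.norm_of_nonneg Real.pi_pos.le]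
      refine (div_le_self (norm_nonneg _) (by linarith [Real.pi_gt_three])).trans ?_
      refine (Complex.norm_sin_le_exp_abs_im _).trans_eq ?_
      simp [abs_mul, abs_of_pos Real.pi_pos]
    rw [Complex.div_ofReal_im, abs_div, abs_of_pos hβ0] at e1
    simp only [Complex.sub_im, Complex.one_im, zero_sub, abs_neg] at e2
    rw [e3, norm_mul, norm_mul]
    calc _ ≤ (C₁ * Real.exp (-θ * (|w.im| / β))) *
          ((C₂ * Real.exp (-θ * |w.im|)) * Real.exp (Real.pi * |w.im|)) := by gcongr
      _ = C₁ * C₂ * Real.exp (-δ * |w.im|) := by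
          have : Real.exp (-δ * |w.im|) = Real.exp (-θ * (|w.im| / β)) *
              (Real.exp (-θ * |w.im|) * Real.exp (Real.pi * |w.im|)) := by
            rw [← Real.exp_add, ← Real.exp_add]
            congr 1
            rw [hδd]
            ring
          rw [this]
          ring
      _ ≤ _ := by
          gcongr
          have : 0 ≤ C₃ * Real.exp δ := by positivity
          linarith
  -- For `|Im w| ≤ 1` compactness suffices; the factor `exp δ` offsets the decaying exponential.
  · have e1 := h₃ w.im (abs_le.1 hy)
    rw [← hw, Complex.re_add_im] at e1
    calc _ ≤ C₃ * 1 := by simpa using e1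
      _ ≤ C₃ * (Real.exp δ * Real.exp (-δ * |w.im|)) := by
          gcongr
          rw [← Real.exp_add]
          apply Real.one_le_exp
          nlinarith
      _ ≤ _ := by
          rw [← mul_assoc]
          gcongr
          have : 0 ≤ C₁ * C₂ := by positivity
          linarith

end GammaDecay

/-! ### Moments of positive stable variables -/

section StableMoments

open Real (exp log Gamma)

theorem lintegral_rpow_mul_exp_neg_mul_rpow {p q b : ℝ} (hp : 0 < p) (hq : -1 < q) (hb : 0 < b) :
    ∫⁻ x in Set.Ioi (0 : ℝ), ENNReal.ofReal (x ^ q * exp (-b * x ^ p)) =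
      ENNReal.ofReal (b ^ (-(q + 1) / p) * (1 / p) * Gamma ((q + 1) / p)) := by
  rw [← integral_rpow_mul_exp_neg_mul_rpow hp hq hb, ofReal_integral_eq_lintegral_ofReal]
  · exact integrableOn_rpow_mul_exp_neg_mul_rpow hq hp hb
  · refine ae_restrict_of_forall_mem measurableSet_Ioi fun x hx => ?_
    exact mul_nonneg (Real.rpow_nonneg (le_of_lt hx) _) (Real.exp_pos _).le

/-- Writing the difference as an integral in `u` allows Tonelli's theorem in the Bernstein
representation below. -/
theorem ofReal_one_sub_exp_eq_lintegral {a x : ℝ} (ha : 0 ≤ a) (hx : 0 ≤ x) :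
    ENNReal.ofReal (1 - exp (-a * x)) =
      ∫⁻ u in Set.Ioc 0 a, ENNReal.ofReal (x * exp (-u * x)) := by
  have hd : ∀ u ∈ Set.uIcc 0 a, HasDerivAt (fun u : ℝ => -exp (-u * x)) (x * exp (-u * x)) u := by
    intro u _
    have := (((hasDerivAt_id u).neg.mul_const x).exp).neg
    convert! this using 1
    simp only [id, Pi.neg_apply]
    ring
  have hc : Continuous fun u : ℝ => x * exp (-u * x) := by fun_prop
  have := intervalIntegral.integral_eq_sub_of_hasDerivAt hd (hc.intervalIntegrable _ _)
  rw [← ofReal_integral_eq_lintegral_ofReal, ← intervalIntegral.integral_of_le ha, this]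
  · congr 1
    simp
    ring
  · exact (hc.intervalIntegrable 0 a).1
  · exact ae_of_all _ fun u => by positivity

/-- The Bernstein representation of `a ^ v`, `0 < v < 1`. -/
theorem lintegral_one_sub_exp_mul_levy {v a : ℝ} (hv0 : 0 < v) (hv1 : v < 1) (ha : 0 ≤ a) :
    ∫⁻ x in Set.Ioi (0 : ℝ), ENNReal.ofReal (v / (Gamma (1 - v) * x ^ (1 + v))) *
      ENNReal.ofReal (1 - exp (-a * x)) = ENNReal.ofReal (a ^ v) := by
  have hG : 0 < Gamma (1 - v) := Real.Gamma_pos_of_pos (by linarith)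
  have e1 : ∀ x ∈ Set.Ioi (0 : ℝ), ENNReal.ofReal (v / (Gamma (1 - v) * x ^ (1 + v))) *
      ENNReal.ofReal (1 - exp (-a * x)) = ∫⁻ u in Set.Ioc 0 a,
        ENNReal.ofReal (v / Gamma (1 - v)) * ENNReal.ofReal (x ^ (-v) * exp (-u * x ^ (1 : ℝ))) := by
    intro x (hx : 0 < x)
    rw [ofReal_one_sub_exp_eq_lintegral ha hx.le, ← lintegral_const_mul _ (by fun_prop)]
    refine lintegral_congr fun u => ?_
    rw [← ENNReal.ofReal_mul (by positivity), ← ENNReal.ofReal_mul (by positivity)]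
    congr 1
    rw [Real.rpow_add hx, Real.rpow_neg hx.le, Real.rpow_one]
    field_simp
  rw [setLIntegral_congr_fun measurableSet_Ioi e1, lintegral_lintegral_swap (by fun_prop)]
  -- The `x`-integral is `Γ(1-v) u^(v-1)`, which cancels the normalisation of the Lévy density.
  have e2 : ∀ u ∈ Set.Ioc 0 a, (∫⁻ x in Set.Ioi (0 : ℝ),
      ENNReal.ofReal (v / Gamma (1 - v)) * ENNReal.ofReal (x ^ (-v) * exp (-u * x ^ (1 : ℝ)))) =
        ENNReal.ofReal (v * u ^ (v - 1)) := by
    intro u hu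
    rw [lintegral_const_mul _ (by fun_prop), lintegral_rpow_mul_exp_neg_mul_rpow one_pos
      (by linarith) hu.1, ← ENNReal.ofReal_mul (by positivity)]
    congr 1
    have h1 : -(-v + 1) / 1 = v - 1 := by ring
    have h2 : (-v + 1) / 1 = 1 - v := by ring
    rw [h1, h2]
    field_simp
  have hi : IntervalIntegrable (fun u : ℝ => v * u ^ (v - 1)) volume 0 a :=
    (intervalIntegral.intervalIntegrable_rpow' (by linarith)).const_mul v
  rw [setLIntegral_congr_fun measurableSet_Ioc e2, ← ofReal_integral_eq_lintegral_ofReal,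
    ← intervalIntegral.integral_of_le ha, intervalIntegral.integral_const_mul,
    integral_rpow (.inl (by linarith))]
  · congr 1
    rw [sub_add_cancel, Real.zero_rpow hv0.ne']
    field_simp
    ring
  · exact hi.1
  · refine ae_restrict_of_forall_mem measurableSet_Ioc fun u hu => ?_
    exact mul_nonneg hv0.le (Real.rpow_nonneg hu.1.le _)

theorem integral_one_sub_exp_stableLevyMeasure {β s : ℝ} (hβ0 : 0 < β) (hβ1 : β < 1)
    (hs : 0 < s) : ∫ x, (1 - exp (-s * x)) ∂stableLevyMeasure β = s ^ β := by
  have hm : Measurable fun x : ℝ => ENNReal.ofReal (β / (Gamma (1 - β) * x ^ (1 + β))) := by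
    fun_prop
  rw [integral_eq_lintegral_of_nonneg_ae, stableLevyMeasure,
    lintegral_withDensity_eq_lintegral_mul _ hm (by fun_prop)]
  · simp only [Pi.mul_apply]
    rw [lintegral_one_sub_exp_mul_levy hβ0 hβ1 hs.le, ENNReal.toReal_ofReal (by positivity)]
  · refine (withDensity_absolutelyContinuous _ _).ae_le ?_
    refine ae_restrict_of_forall_mem measurableSet_Ioi fun x (hx : 0 < x) => ?_
    simp only [Pi.zero_apply, sub_nonneg, Real.exp_le_one_iff]
    nlinarith
  · fun_prop

variable {Ω : Type*} [MeasurableSpace Ω] {P : Measure Ω} {X : Ω → ℝ}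

/-- `X` is nonnegative with Laplace transform `s ↦ exp (-τ s ^ β)`. -/
structure IsPositiveStable (X : Ω → ℝ) (P : Measure Ω) (β τ : ℝ) : Prop where
  measurable : Measurable X
  nonneg : ∀ᵐ ω ∂P, 0 ≤ X ω
  laplace : ∀ s, 0 < s → ∫ ω, exp (-s * X ω) ∂P = exp (-τ * s ^ β)

theorem IsStableSubordinator.isPositiveStable {D : ℝ≥0 → Ω → ℝ} {β : ℝ} (hβ0 : 0 < β)
    (hβ1 : β < 1) (hD : IsStableSubordinator D P β) (t : ℝ≥0) :
    IsPositiveStable (D t) P β t where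
  measurable := hD.measurable t
  nonneg := by
    filter_upwards [hD.zero, hD.monotone] with ω h0 hm
    exact h0.symm.le.trans (hm zero_le)
  laplace s hs := by
    rw [hD.laplace t s hs, integral_one_sub_exp_stableLevyMeasure hβ0 hβ1 hs]
    simp

namespace IsPositiveStable

variable {β τ : ℝ} [IsProbabilityMeasure P]

theorem integrable_exp (h : IsPositiveStable X P β τ) {s : ℝ} (hs : 0 < s) :
    Integrable (fun ω => exp (-s * X ω)) P := by
  refine Integrable.of_bound (C := 1) (by have := h.measurable; fun_prop) ?_
  filter_upwards [h.nonneg] with ω hω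
  rw [Real.norm_of_nonneg (Real.exp_pos _).le, Real.exp_le_one_iff]
  nlinarith

theorem lintegral_exp (h : IsPositiveStable X P β τ) {s : ℝ} (hs : 0 < s) :
    ∫⁻ ω, ENNReal.ofReal (exp (-s * X ω)) ∂P = ENNReal.ofReal (exp (-τ * s ^ β)) := by
  rw [← h.laplace s hs, ofReal_integral_eq_lintegral_ofReal (h.integrable_exp hs)
    (ae_of_all _ fun _ => (Real.exp_pos _).le)]

theorem lintegral_one_sub_exp (h : IsPositiveStable X P β τ) {s : ℝ} (hs : 0 < s) :
    ∫⁻ ω, ENNReal.ofReal (1 - exp (-s * X ω)) ∂P = ENNReal.ofReal (1 - exp (-τ * s ^ β)) := by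
  have h1 : ∫ ω, (1 - exp (-s * X ω)) ∂P = 1 - exp (-τ * s ^ β) := by
    rw [integral_sub (integrable_const _) (h.integrable_exp hs), h.laplace s hs]
    simp
  rw [← h1, ofReal_integral_eq_lintegral_ofReal (f := fun ω => 1 - exp (-s * X ω))
    ((integrable_const _).sub (h.integrable_exp hs))]
  filter_upwards [h.nonneg] with ω hω
  simp only [Pi.zero_apply, sub_nonneg, Real.exp_le_one_iff]
  nlinarith

/-- Markov's bound `P(X ≤ 0) ≤ E exp(-sX) = exp(-τ s^β)` tends to `0` as `s → ∞`. -/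
theorem ae_pos (h : IsPositiveStable X P β τ) (hβ : 0 < β) (hτ : 0 < τ) : ∀ᵐ ω ∂P, 0 < X ω := by
  have h1 : ∀ s > 0, P {ω | ¬ 0 < X ω} ≤ ENNReal.ofReal (exp (-τ * s ^ β)) := by
    intro s hs
    have hA : MeasurableSet {ω | ¬ 0 < X ω} :=
      (measurableSet_lt measurable_const h.measurable).compl
    rw [← h.lintegral_exp hs, ← lintegral_indicator_one hA]
    refine lintegral_mono fun ω => ?_
    refine Set.indicator_le' (g := fun ω => ENNReal.ofReal (exp (-s * X ω)))
      (fun ω hω => ?_) (fun _ _ => zero_le) ω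
    rw [Pi.one_apply, ENNReal.one_le_ofReal]
    apply Real.one_le_exp
    have : X ω ≤ 0 := not_lt.1 hω
    nlinarith
  have h2 : Tendsto (fun s : ℝ => ENNReal.ofReal (exp (-τ * s ^ β))) atTop (𝓝 0) := by
    rw [← ENNReal.ofReal_zero]
    refine ENNReal.tendsto_ofReal (Real.tendsto_exp_atBot.comp ?_)
    exact (tendsto_rpow_atTop hβ).const_mul_atTop_of_neg (neg_lt_zero.2 hτ)
  exact le_antisymm (ge_of_tendsto h2 ((eventually_gt_atTop 0).mono h1)) zero_le

/-- Evaluate `E ∫ s^(w-1) exp(-sX) ds` in both orders: one gives `Γ(w) E X^(-w)`, the other a Gamma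
integral of `exp(-τ s^β)`. -/
theorem lintegral_exp_neg_mul_log (h : IsPositiveStable X P β τ) (hβ : 0 < β) (hτ : 0 < τ)
    {w : ℝ} (hw : 0 < w) :
    ∫⁻ ω, ENNReal.ofReal (exp (-w * log (X ω))) ∂P =
      ENNReal.ofReal (τ ^ (-w / β) * (1 / β) * Gamma (w / β) / Gamma w) := by
  have hG : 0 < Gamma w := Real.Gamma_pos_of_pos hw
  have hX := h.measurable
  have e1 : ∫⁻ ω, (∫⁻ s in Set.Ioi (0 : ℝ), ENNReal.ofReal (s ^ (w - 1)) *
      ENNReal.ofReal (exp (-s * X ω))) ∂P =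
        ENNReal.ofReal (Gamma w) * ∫⁻ ω, ENNReal.ofReal (exp (-w * log (X ω))) ∂P := by
    rw [← lintegral_const_mul _ (by fun_prop)]
    refine lintegral_congr_ae ?_
    filter_upwards [h.ae_pos hβ hτ] with ω hω
    have := lintegral_rpow_mul_exp_neg_mul_rpow one_pos (q := w - 1) (by linarith) hω
    rw [← ENNReal.ofReal_mul hG.le]
    refine Eq.trans (setLIntegral_congr_fun measurableSet_Ioi fun s (hs : 0 < s) => ?_)
      (this.trans ?_)
    · rw [← ENNReal.ofReal_mul (Real.rpow_nonneg hs.le _), Real.rpow_one]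
      congr 3
      ring
    · congr 1
      have h1 : -(w - 1 + 1) / 1 = -w := by ring
      have h2 : (w - 1 + 1) / 1 = w := by ring
      rw [h1, h2, Real.rpow_def_of_pos hω, mul_comm (log _)]
      ring
  have e2 : ∫⁻ s in Set.Ioi (0 : ℝ), ∫⁻ ω, ENNReal.ofReal (s ^ (w - 1)) *
      ENNReal.ofReal (exp (-s * X ω)) ∂P =
        ENNReal.ofReal (τ ^ (-w / β) * (1 / β) * Gamma (w / β)) := by
    have := lintegral_rpow_mul_exp_neg_mul_rpow hβ (q := w - 1) (by linarith) hτ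
    rw [sub_add_cancel] at this
    rw [← this]
    refine setLIntegral_congr_fun measurableSet_Ioi fun s (hs : 0 < s) => ?_
    rw [lintegral_const_mul _ (by fun_prop), h.lintegral_exp hs,
      ← ENNReal.ofReal_mul (Real.rpow_nonneg hs.le _)]
  rw [lintegral_lintegral_swap (by fun_prop), e2] at e1
  rw [ENNReal.ofReal_div_of_pos hG, e1, mul_comm, ENNReal.mul_div_cancel_right] <;> simp [hG]

theorem integrable_exp_neg_mul_log (h : IsPositiveStable X P β τ) (hβ : 0 < β) (hτ : 0 < τ)
    {w : ℝ} (hw : 0 < w) : Integrable (fun ω => exp (-w * log (X ω))) P := by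
  have hX := h.measurable
  refine ⟨(hX.log.const_mul _).exp.aestronglyMeasurable, ?_⟩
  rw [hasFiniteIntegral_iff_ofReal (ae_of_all _ fun _ => (Real.exp_pos _).le),
    h.lintegral_exp_neg_mul_log hβ hτ hw]
  exact ENNReal.ofReal_lt_top

/-- The integrand is `O(x^(β-1-v))` at `0`, integrable as `v < β`, and `O(x^(-1-v))` at infinity,
integrable as `v > 0`. -/
theorem lintegral_Ioi_one_sub_exp_mul_levy_lt_top {v : ℝ} (hv0 : 0 < v) (hvβ : v < β)
    (c : ℝ) (hc : 0 ≤ c) :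
    ∫⁻ x in Set.Ioi (0 : ℝ), ENNReal.ofReal (c / x ^ (1 + v)) *
      ENNReal.ofReal (1 - exp (-τ * x ^ β)) < ∞ := by
  rw [← Set.Ioc_union_Ioi_eq_Ioi zero_le_one]
  refine (lintegral_union_le _ _ _).trans_lt (ENNReal.add_lt_top.2 ⟨?_, ?_⟩)
  · have hi : IntegrableOn (fun x : ℝ => c * τ * x ^ (β - 1 - v)) (Set.Ioc 0 1) :=
      ((intervalIntegral.intervalIntegrable_rpow' (a := 0) (b := 1) (by linarith)).const_mul _).1
    refine lt_of_le_of_lt ?_ hi.lintegral_lt_top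
    refine setLIntegral_mono' measurableSet_Ioc fun x hx => ?_
    have hx0 := hx.1
    rw [← ENNReal.ofReal_mul (by positivity)]
    apply ENNReal.ofReal_le_ofReal
    have h1 : 1 - exp (-τ * x ^ β) ≤ τ * x ^ β := by
      linarith [Real.add_one_le_exp (-τ * x ^ β)]
    calc c / x ^ (1 + v) * (1 - exp (-τ * x ^ β)) ≤ c / x ^ (1 + v) * (τ * x ^ β) := by gcongr
      _ = c * τ * x ^ (β - 1 - v) := by
        rw [sub_sub, Real.rpow_sub hx0]
        ring
  · have hi : IntegrableOn (fun x : ℝ => c * x ^ (-(1 + v))) (Set.Ioi 1) :=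
      (integrableOn_Ioi_rpow_of_lt (by linarith) one_pos).const_mul c
    refine lt_of_le_of_lt ?_ hi.lintegral_lt_top
    refine setLIntegral_mono' measurableSet_Ioi fun x (hx : 1 < x) => ?_
    have hx0 : 0 < x := one_pos.trans hx
    rw [← ENNReal.ofReal_mul (by positivity)]
    apply ENNReal.ofReal_le_ofReal
    rw [Real.rpow_neg hx0.le, ← div_eq_mul_inv]
    exact mul_le_of_le_one_right (by positivity) (by linarith [Real.exp_pos (-τ * x ^ β)])

/-- For `v > 0`, apply the Bernstein representation to `X^v` and exchange integrals: only `1 - E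
exp(-xX)`, which is explicit, remains inside. -/
theorem integrable_exp_mul_log (h : IsPositiveStable X P β τ) (hβ0 : 0 < β) (hβ1 : β < 1)
    (hτ : 0 < τ) {v : ℝ} (hv : v < β) : Integrable (fun ω => exp (v * log (X ω))) P := by
  rcases lt_trichotomy v 0 with hv0 | rfl | hv0
  · simpa using h.integrable_exp_neg_mul_log hβ0 hτ (neg_pos.2 hv0)
  · simp
  have hX := h.measurable
  have hG : 0 < Gamma (1 - v) := Real.Gamma_pos_of_pos (by linarith)
  refine ⟨(hX.log.const_mul _).exp.aestronglyMeasurable, ?_⟩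
  rw [hasFiniteIntegral_iff_ofReal (ae_of_all _ fun _ => (Real.exp_pos _).le)]
  have e1 : ∫⁻ ω, ENNReal.ofReal (exp (v * log (X ω))) ∂P =
      ∫⁻ ω, (∫⁻ x in Set.Ioi (0 : ℝ), ENNReal.ofReal (v / (Gamma (1 - v) * x ^ (1 + v))) *
        ENNReal.ofReal (1 - exp (-X ω * x))) ∂P := by
    refine lintegral_congr_ae ?_
    filter_upwards [h.ae_pos hβ0 hτ] with ω hω
    rw [lintegral_one_sub_exp_mul_levy hv0 (hv.trans hβ1) hω.le, Real.rpow_def_of_pos hω, mul_comm]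
  rw [e1, lintegral_lintegral_swap (by fun_prop)]
  refine lt_of_eq_of_lt ?_ (lintegral_Ioi_one_sub_exp_mul_levy_lt_top (τ := τ) hv0 hv
    (v / Gamma (1 - v)) (by positivity))
  refine setLIntegral_congr_fun measurableSet_Ioi fun x (hx : 0 < x) => ?_
  rw [lintegral_const_mul _ (by fun_prop), ← h.lintegral_one_sub_exp hx, div_div]
  simp only [neg_mul, mul_comm x]

theorem mem_interior_integrableExpSet (h : IsPositiveStable X P β τ) (hβ0 : 0 < β) (hβ1 : β < 1)
    (hτ : 0 < τ) {v : ℝ} (hv : v < β) :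
    v ∈ interior (integrableExpSet (fun ω => log (X ω)) P) :=
  mem_interior.2 ⟨Set.Iio β, fun _ hu => h.integrable_exp_mul_log hβ0 hβ1 hτ hu, isOpen_Iio, hv⟩

/-- Both sides are analytic for `Re z < β` and agree at real points near `-1`, where the negative
moments are explicit. The shifted Gamma arguments keep the right side regular at `z = 0`. -/
theorem complexMGF_log (h : IsPositiveStable X P β τ) (hβ0 : 0 < β) (hβ1 : β < 1)
    (hτ : 0 < τ) {z : ℂ} (hz : z.re < β) :
    complexMGF (fun ω => log (X ω)) P z =
      (τ : ℂ) ^ (z / β) * Complex.Gamma (1 - z / β) * (Complex.Gamma (1 - z))⁻¹ := by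
  set U : Set ℂ := {z | z.re < β} with hU
  have hUo : IsOpen U := isOpen_lt Complex.continuous_re continuous_const
  have hUc : IsPreconnected U := (convex_halfSpace_re_lt β).isPreconnected
  have hτ' : (τ : ℂ) ≠ 0 := by exact_mod_cast hτ.ne'
  have hf : AnalyticOnNhd ℂ (complexMGF (fun ω => log (X ω)) P) U := fun z hz =>
    analyticAt_complexMGF (h.mem_interior_integrableExpSet hβ0 hβ1 hτ hz)
  have hg : AnalyticOnNhd ℂ (fun z : ℂ =>
      (τ : ℂ) ^ (z / β) * Complex.Gamma (1 - z / β) * (Complex.Gamma (1 - z))⁻¹) U := by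
    refine DifferentiableOn.analyticOnNhd (fun z hz => ?_) hUo
    refine (DifferentiableAt.mul (DifferentiableAt.mul ?_ ?_) ?_).differentiableWithinAt
    · exact DifferentiableAt.const_cpow (by fun_prop) (.inl hτ')
    · refine DifferentiableAt.comp z (f := fun z : ℂ => 1 - z / β)
        (Complex.differentiableAt_Gamma _ fun m hm => ?_) (by fun_prop)
      have := congrArg Complex.re hm
      simp only [Complex.sub_re, Complex.one_re, Complex.div_ofReal_re, Complex.neg_re,
        Complex.natCast_re] at this
      have h1 : z.re / β < 1 := (div_lt_one hβ0).2 hz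
      have h2 : (0 : ℝ) ≤ m := m.cast_nonneg
      linarith
    · exact (Complex.differentiable_one_div_Gamma _).comp z
        (f := fun z : ℂ => 1 - z) (by fun_prop)
  refine hf.eqOn_of_preconnected_of_frequently_eq hg hUc (z₀ := ((-1 : ℝ) : ℂ))
    (by simp [hU]; linarith) ?_ hz
  have h_real : ∃ᶠ x : ℝ in 𝓝[≠] (-1), complexMGF (fun ω => log (X ω)) P x =
      (τ : ℂ) ^ ((x : ℂ) / β) * Complex.Gamma (1 - x / β) * (Complex.Gamma (1 - x))⁻¹ := by
    refine Eventually.frequently ?_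
    filter_upwards [nhdsWithin_le_nhds (eventually_lt_nhds (show (-1 : ℝ) < 0 by norm_num))]
      with x hx
    have hx' : 0 < -x := neg_pos.2 hx
    have hG : 0 < Gamma (-x) := Real.Gamma_pos_of_pos hx'
    have hG' : 0 < Gamma (-x / β) := Real.Gamma_pos_of_pos (by positivity)
    have e := h.lintegral_exp_neg_mul_log hβ0 hτ hx'
    rw [neg_neg] at e
    rw [complexMGF_ofReal, mgf, integral_eq_lintegral_of_nonneg_ae
      (ae_of_all _ fun _ => (Real.exp_pos _).le) (h.measurable.log.const_mul _).exp.aestronglyMeasurable, e,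
      ENNReal.toReal_ofReal (by positivity)]
    have e1 : (1 : ℂ) - x / β = ((-x / β + 1 : ℝ) : ℂ) := by push_cast; ring
    have e2 : (1 : ℂ) - x = ((-x + 1 : ℝ) : ℂ) := by push_cast; ring
    rw [e1, e2, Complex.Gamma_ofReal, Complex.Gamma_ofReal, Real.Gamma_add_one (by positivity),
      Real.Gamma_add_one hx'.ne', ← Complex.ofReal_div, ← Complex.ofReal_cpow hτ.le,
      ← Complex.ofReal_mul, ← Complex.ofReal_inv, ← Complex.ofReal_mul]
    congr 1
    have hx0 : x ≠ 0 := hx.ne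
    field_simp
  rw [frequently_iff_seq_forall] at h_real ⊢
  obtain ⟨xs, hx_tendsto, hx_eq⟩ := h_real
  refine ⟨fun n => xs n, ?_, fun n => hx_eq n⟩
  rw [tendsto_nhdsWithin_iff] at hx_tendsto ⊢
  refine ⟨?_, ?_⟩
  · rw [tendsto_ofReal_iff]
    exact hx_tendsto.1
  · filter_upwards [hx_tendsto.2] with n hn
    exact fun h => hn (Complex.ofReal_injective h)

/-- The shape met in Fox kernels. The point `w = 0` is excluded because the convention
`Complex.Gamma 0 = 0` makes the right side `0` there. -/
theorem complexMGF_log_neg (h : IsPositiveStable X P β τ) (hβ0 : 0 < β) (hβ1 : β < 1)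
    (hτ : 0 < τ) {w : ℂ} (hw : -β < w.re) (hw0 : w ≠ 0) :
    complexMGF (fun ω => log (X ω)) P (-w) =
      (τ : ℂ) ^ (-w / β) * (1 / β) * (Complex.Gamma (w / β) * (Complex.Gamma w)⁻¹) := by
  have hβ : (β : ℂ) ≠ 0 := by exact_mod_cast hβ0.ne'
  rw [h.complexMGF_log hβ0 hβ1 hτ (by simpa using neg_lt.1 hw)]
  have e1 : 1 - -w / β = w / β + 1 := by ring
  have e2 : 1 - -w = w + 1 := by ring
  rw [e1, e2, Complex.Gamma_add_one _ (div_ne_zero hw0 hβ), Complex.Gamma_add_one _ hw0, mul_inv]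
  field_simp

end IsPositiveStable

end StableMoments

/-! ### From Mellin transforms to Fox densities -/

section FoxDensity

variable {Ω : Type*} [MeasurableSpace Ω] {P : Measure Ω}

theorem HasPositiveDensity.congr {X Y : Ω → ℝ} {f g : ℝ → ℂ} (h : HasPositiveDensity X P f)
    (hXY : Y =ᵐ[P] X) (hfg : ∀ x, 0 < x → g x = f x) : HasPositiveDensity Y P g := by
  obtain ⟨hX, d, hd, hd0, hdf, hmap⟩ := h
  refine ⟨hX.congr hXY.symm, d, hd, hd0, fun x hx => ?_, ?_⟩
  · rw [hfg x hx]
    exact hdf x hx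
  · rw [Measure.map_congr hXY, hmap]

theorem mellinInv_const_mul_cpow {f M : ℂ → ℂ} {c b : ℝ} (K : ℂ) (hb : 0 < b)
    (h : ∀ y : ℝ, M (c + y * Complex.I) =
      K * (b : ℂ) ^ (c + y * Complex.I : ℂ) * f (c + y * Complex.I)) {x : ℝ} (hx : 0 < x) :
    mellinInv c M x = K * mellinInv c f (x / b) := by
  rw [mellinInv, mellinInv, mul_smul_comm, ← integral_const_mul]
  congr 1
  refine integral_congr_ae (ae_of_all _ fun y => ?_)
  simp only [smul_eq_mul]
  rw [h, Complex.ofReal_div, Complex.div_cpow_ofReal_nonneg hx.le hb.le, Complex.cpow_neg (b : ℂ),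
    div_inv_eq_mul]
  ring

theorem eqOn_Ioi_of_withDensity_eq {f g : ℝ → ℝ} (hf : Measurable f) (hg : Measurable g)
    (hfc : ContinuousOn f (Set.Ioi 0)) (hgc : ContinuousOn g (Set.Ioi 0))
    (hf0 : ∀ x, 0 < x → 0 ≤ f x) (hg0 : ∀ x, 0 < x → 0 ≤ g x)
    (hfin : IsFiniteMeasure (volume.withDensity fun x => ENNReal.ofReal (f x)))
    (h : (volume.withDensity fun x => ENNReal.ofReal (f x)) =
      volume.withDensity fun x => ENNReal.ofReal (g x)) : Set.EqOn f g (Set.Ioi 0) := by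
  have hfi : ∫⁻ x, ENNReal.ofReal (f x) ≠ ∞ := by
    rw [← setLIntegral_univ, ← withDensity_apply _ MeasurableSet.univ]
    exact measure_ne_top _ _
  rw [withDensity_eq_iff (by fun_prop) (by fun_prop) hfi] at h
  refine Measure.eqOn_open_of_ae_eq (μ := volume) ?_ isOpen_Ioi hfc hgc
  filter_upwards [ae_restrict_of_ae h, ae_restrict_mem measurableSet_Ioi] with x hx h0
  exact (ENNReal.ofReal_eq_ofReal_iff (hf0 x h0) (hg0 x h0)).1 hx

/-- If on every admissible line the Mellin transform of a positive random variable `X` is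
`K b ^ s χ(s)`, with `χ` the kernel of a Fox function `H`, then `H` is well defined and `X` has
density `K H(x / b)`. -/
theorem foxHExists_and_hasPositiveDensity [IsProbabilityMeasure P] {X : Ω → ℝ}
    (hX : AEMeasurable X P) (hpos : ∀ᵐ ω ∂P, 0 < X ω) {m n p q : ℕ} {u : Fin p → ℂ × ℝ}
    {l : Fin q → ℂ × ℝ} (hm : m ≤ q) (hn : n ≤ p) (hu : ∀ i, 0 < (u i).2) (hl : ∀ j, 0 < (l j).2)
    (hex : ∃ c : ℝ, IsFoxContour m n u l c) {K b : ℝ} (hK : K ≠ 0) (hb : 0 < b)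
    (hvert : ∀ c : ℝ, IsFoxContour m n u l c → Complex.VerticalIntegrable (foxKernel m n u l) c)
    (hint : ∀ c : ℝ, IsFoxContour m n u l c →
      Integrable (fun ω => Real.exp ((c - 1) * Real.log (X ω))) P)
    (hM : ∀ c : ℝ, IsFoxContour m n u l c → ∀ y : ℝ,
      complexMGF (fun ω => Real.log (X ω)) P (c + y * Complex.I - 1) =
        K * (b : ℂ) ^ (c + y * Complex.I : ℂ) * foxKernel m n u l (c + y * Complex.I)) :
    FoxHExists m n u l ∧ HasPositiveDensity X P (fun x => K * foxH m n u l (x / b)) := by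
  have hK' : (K : ℂ) ≠ 0 := by exact_mod_cast hK
  have hb' : (b : ℂ) ≠ 0 := by exact_mod_cast hb.ne'
  have key : ∀ c : ℝ, IsFoxContour m n u l c → ∃ g : ℝ → ℝ, Measurable g ∧
      ContinuousOn g (Set.Ioi 0) ∧ (∀ x ≤ 0, g x = 0) ∧ (∀ x, 0 < x → 0 ≤ g x ∧
        (g x : ℂ) = K * mellinInv c (foxKernel m n u l) (x / b)) ∧
      P.map X = volume.withDensity (fun x => ENNReal.ofReal (g x)) := by
    intro c hc
    have hMi : Integrable fun y : ℝ => complexMGF (fun ω => Real.log (X ω)) P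
        ((c : ℂ) + y * Complex.I - 1) := by
      simp only [hM c hc]
      refine Integrable.bdd_mul (c := ‖(K : ℂ)‖ * b ^ c) (hvert c hc) ?_ (ae_of_all _ fun y => ?_)
      · refine Continuous.aestronglyMeasurable (continuous_const.mul ?_)
        exact Continuous.const_cpow (by fun_prop) (.inl hb')
      · rw [norm_mul, Complex.norm_cpow_eq_rpow_re_of_pos hb]
        simp
    obtain ⟨g, h1, h2, h3, h4, h5⟩ := exists_density_eq_mellinInv P hX hpos (hint c hc) hMi
    refine ⟨g, h1, h2, h3, fun x hx => ⟨(h4 x hx).1, ?_⟩, h5⟩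
    rw [(h4 x hx).2, mellinInv_const_mul_cpow (K : ℂ) hb (hM c hc) hx]
  -- Both integrals are, up to `K` and scaling, continuous densities of the law of `X`, hence equal
  -- pointwise and not only almost everywhere.
  have huniq : ∀ c c' : ℝ, IsFoxContour m n u l c → IsFoxContour m n u l c' → ∀ z : ℝ, 0 < z →
      mellinInv c (foxKernel m n u l) z = mellinInv c' (foxKernel m n u l) z := by
    intro c c' hc hc' z hz
    obtain ⟨g, h1, h2, h3, h4, h5⟩ := key c hc
    obtain ⟨g', h1', h2', h3', h4', h5'⟩ := key c' hc'
    have hfin : IsFiniteMeasure (P.map X) := inferInstance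
    rw [h5] at hfin
    have := eqOn_Ioi_of_withDensity_eq h1 h1' h2 h2' (fun x hx => (h4 x hx).1)
      (fun x hx => (h4' x hx).1) hfin (h5.symm.trans h5')
    have hzb : 0 < z * b := mul_pos hz hb
    have e := (h4 _ hzb).2
    rw [this hzb, (h4' _ hzb).2, mul_div_cancel_right₀ _ hb.ne'] at e
    exact (mul_left_cancel₀ hK' e).symm
  have hfox : ∀ c : ℝ, IsFoxContour m n u l c → ∀ z : ℝ, 0 < z →
      foxH m n u l z = mellinInv c (foxKernel m n u l) z := by
    intro c hc z hz
    rw [foxH, dif_pos hex]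
    exact huniq _ _ hex.choose_spec hc z hz
  refine ⟨⟨hm, hn, hu, hl, hex, hvert, hfox⟩, hX, ?_⟩
  obtain ⟨c, hc⟩ := hex
  obtain ⟨g, h1, h2, h3, h4, h5⟩ := key c hc
  refine ⟨g, h1, h3, fun x hx => ⟨(h4 x hx).1, ?_⟩, h5⟩
  beta_reduce
  rw [hfox c hc _ (div_pos hx hb), (h4 x hx).2]

end FoxDensity

/-! ### Genuine and removable singularities -/

section Singularities

theorem IsGenuineSingularity.of_mul_eventuallyEq {f E G : ℂ → ℂ} {s g : ℂ}
    (h : ∀ᶠ z in 𝓝[≠] s, f z * E z = G z) (hE : Tendsto E (𝓝[≠] s) (𝓝 0))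
    (hG : Tendsto G (𝓝[≠] s) (𝓝 g)) (hg : g ≠ 0) : IsGenuineSingularity f s := by
  rintro ⟨w, hw⟩
  have h1 := (hw.mul hE).congr' h
  rw [mul_zero] at h1
  exact hg (tendsto_nhds_unique hG h1)

/-- In effect, poles are isolated, since `Complex.Gamma` vanishes exactly there. The entire function
`1/Γ(a + A z)` is not identically zero, being `1` where `a + A z = 1`. -/
theorem Complex.eventually_Gamma_ne_zero {a A : ℂ} (hA : A ≠ 0) (s : ℂ) :
    ∀ᶠ z in 𝓝[≠] s, Complex.Gamma (a + A * z) ≠ 0 := by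
  have hd : Differentiable ℂ fun z => (Complex.Gamma (a + A * z))⁻¹ :=
    Complex.differentiable_one_div_Gamma.comp (by fun_prop)
  have han : AnalyticOnNhd ℂ (fun z => (Complex.Gamma (a + A * z))⁻¹) Set.univ := fun z _ =>
    hd.analyticAt z
  rcases (han s trivial).eventually_eq_zero_or_eventually_ne_zero with h | h
  · have := han.eqOn_zero_of_preconnected_of_eventuallyEq_zero isPreconnected_univ trivial h
      (Set.mem_univ ((1 - a) / A))
    simp [mul_div_cancel₀ _ hA] at this
  · filter_upwards [h] with z hz h0
    simp [h0] at hz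

/-- The two simple poles at `0` cancel: off `0` the ratio is `β Γ(w/β + 1)/Γ(w + 1)`. -/
theorem tendsto_Gamma_ratio {β : ℝ} (hβ : β ≠ 0) :
    Tendsto (fun w : ℂ => Complex.Gamma (w / β) * (Complex.Gamma w)⁻¹) (𝓝[≠] 0) (𝓝 β) := by
  have hβ' : (β : ℂ) ≠ 0 := by exact_mod_cast hβ
  have h1 : ContinuousAt (fun w : ℂ => (β : ℂ) * (Complex.Gamma (w / β + 1) *
      (Complex.Gamma (w + 1))⁻¹)) 0 := by
    have hG := Complex.differentiableAt_Gamma_one.continuousAt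
    refine continuousAt_const.mul (ContinuousAt.mul ?_ (ContinuousAt.inv₀ ?_ ?_))
    · exact ContinuousAt.comp (g := Complex.Gamma) (by simpa using hG) (by fun_prop)
    · exact ContinuousAt.comp (g := Complex.Gamma) (by simpa using hG) (by fun_prop)
    · simp
  have h2 := h1.tendsto.mono_left (nhdsWithin_le_nhds (s := {0}ᶜ))
  simp only [zero_div, zero_add, Complex.Gamma_one, inv_one, mul_one] at h2
  refine h2.congr' ?_
  filter_upwards [self_mem_nhdsWithin] with w hw
  rw [Complex.Gamma_add_one _ (div_ne_zero hw hβ'), Complex.Gamma_add_one _ hw, mul_inv]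
  have hw' : w ≠ 0 := hw
  field_simp

theorem integrable_exp_neg_mul_abs {δ : ℝ} (hδ : 0 < δ) :
    Integrable fun y : ℝ => Real.exp (-δ * |y|) := by
  refine (integrable_inv_one_add_sq.const_mul (1 + 2 / δ ^ 2)).mono'
    (Continuous.aestronglyMeasurable (by fun_prop)) (ae_of_all _ fun y => ?_)
  have h1 := Real.quadratic_le_exp_of_nonneg (x := δ * |y|) (by positivity)
  have h2 : (δ * |y|) ^ 2 = δ ^ 2 * y ^ 2 := by rw [mul_pow, sq_abs]
  rw [Real.norm_of_nonneg (Real.exp_pos _).le, neg_mul, Real.exp_neg, ← div_eq_mul_inv,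
    inv_eq_one_div, div_le_div_iff₀ (Real.exp_pos _) (by positivity)]
  calc 1 * (1 + y ^ 2) ≤ (1 + 2 / δ ^ 2) * (1 + (δ * |y|) ^ 2 / 2) := by
        have : (1 + 2 / δ ^ 2) * (1 + (δ * |y|) ^ 2 / 2) =
            1 + y ^ 2 + 2 / δ ^ 2 + δ ^ 2 * y ^ 2 / 2 := by
          rw [h2]
          field_simp
          ring
        have h3 : 0 ≤ 2 / δ ^ 2 + δ ^ 2 * y ^ 2 / 2 := by positivity
        linarith
    _ ≤ _ := by
        gcongr
        have : 0 ≤ δ * |y| := by positivity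
        linarith

end Singularities

/-! ### Products of powers of independent stable variables -/

section StableProducts

theorem Complex.finset_prod_ofReal_cpow {α : Type*} (A : Finset α) {f : α → ℝ}
    (hf : ∀ i ∈ A, 0 ≤ f i) (s : ℂ) : (∏ i ∈ A, (f i : ℂ)) ^ s = ∏ i ∈ A, (f i : ℂ) ^ s := by
  classical
  induction A using Finset.induction_on with
  | empty => simp
  | insert i A hi ih =>
    rw [Finset.prod_insert hi, Finset.prod_insert hi, ← ih fun j hj => hf j (by simp [hj]),
      ← Complex.ofReal_prod, Complex.mul_cpow_ofReal_nonneg (hf i (by simp))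
      (Finset.prod_nonneg fun j hj => hf j (by simp [hj]))]

variable {ι : Type*} [Fintype ι] {β ρ : ι → ℝ}

/-- The Mellin–Barnes kernel attached to a product of powers `∏ X_i ^ ρ_i` of positive `β_i`-stable
random variables. -/
noncomputable def stableKernel (β ρ : ι → ℝ) (s : ℂ) : ℂ :=
  ∏ i, Complex.Gamma (ρ i * (1 - s) / β i) * (Complex.Gamma (ρ i * (1 - s)))⁻¹

/-- The kernel `H^{m,n}_{p,q}[· | u; l]` is the kernel of `∏ X_i ^ ρ_i`, and its numerator
singularities are attributed to the left for `ρ_i < 0` and to the right for `ρ_i > 0`. -/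
structure IsStableFoxKernel (β ρ : ι → ℝ) (m n : ℕ) {p q : ℕ} (u : Fin p → ℂ × ℝ)
    (l : Fin q → ℂ × ℝ) : Prop where
  m_le : m ≤ q
  n_le : n ≤ p
  upper_pos : ∀ i, 0 < (u i).2
  lower_pos : ∀ j, 0 < (l j).2
  kernel : ∀ s, foxKernel m n u l s = stableKernel β ρ s
  left : ∀ s, s ∈ foxLeftPoles m l ↔ ∃ i, ρ i < 0 ∧ ∃ k : ℕ, (ρ i : ℂ) * (1 - s) / β i = -k
  right : ∀ s, s ∈ foxRightPoles n u ↔ ∃ i, 0 < ρ i ∧ ∃ k : ℕ, (ρ i : ℂ) * (1 - s) / β i = -k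

/-- Here the `i`-th numerator argument is `-1`, a pole. As all `|ρ_j|` are equal, every denominator
argument has modulus `β_i ∈ (0, 1)`, so no reciprocal Gamma factor vanishes to cancel it. -/
theorem isGenuineSingularity_stableKernel (hβ0 : ∀ i, 0 < β i) (hβ1 : ∀ i, β i < 1) {r : ℝ}
    (hr : 0 < r) (hρ : ∀ i, |ρ i| = r) (i : ι) :
    IsGenuineSingularity (stableKernel β ρ) ((1 + β i / ρ i : ℝ) : ℂ) := by
  have hρ0 : ∀ j, (ρ j : ℂ) ≠ 0 := fun j => by
    have : ρ j ≠ 0 := abs_pos.1 (by rw [hρ j]; exact hr)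
    exact_mod_cast this
  have hβ : ∀ j, (β j : ℂ) ≠ 0 := fun j => by exact_mod_cast (hβ0 j).ne'
  have hE : Continuous fun z : ℂ => ∏ j, (Complex.Gamma (ρ j * (1 - z) / β j))⁻¹ :=
    continuous_finsetProd _ fun j _ =>
      Complex.differentiable_one_div_Gamma.continuous.comp (by fun_prop)
  have hG : Continuous fun z : ℂ => ∏ j, (Complex.Gamma (ρ j * (1 - z)))⁻¹ :=
    continuous_finsetProd _ fun j _ =>
      Complex.differentiable_one_div_Gamma.continuous.comp (by fun_prop)
  refine IsGenuineSingularity.of_mul_eventuallyEq (G := fun z : ℂ =>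
    ∏ j, (Complex.Gamma (ρ j * (1 - z)))⁻¹) ?_ ?_
    (hG.continuousAt.tendsto.mono_left nhdsWithin_le_nhds) ?_
    (E := fun z : ℂ => ∏ j, (Complex.Gamma (ρ j * (1 - z) / β j))⁻¹)
  · have : ∀ j, ∀ᶠ z in 𝓝[≠] ((1 + β i / ρ i : ℝ) : ℂ),
        Complex.Gamma (ρ j * (1 - z) / β j) ≠ 0 := by
      intro j
      have := Complex.eventually_Gamma_ne_zero (a := ρ j / β j) (A := -(ρ j / β j))
        (neg_ne_zero.2 (div_ne_zero (hρ0 j) (hβ j))) ((1 + β i / ρ i : ℝ) : ℂ)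
      filter_upwards [this] with z hz
      convert hz using 2
      ring
    filter_upwards [eventually_all.2 this] with z hz
    rw [stableKernel, ← Finset.prod_mul_distrib]
    refine Finset.prod_congr rfl fun j _ => ?_
    rw [mul_right_comm, mul_inv_cancel₀ (hz j), one_mul]
  · have h0 : ∏ j, (Complex.Gamma (ρ j * (1 - ((1 + β i / ρ i : ℝ) : ℂ)) / β j))⁻¹ = 0 := by
      refine Finset.prod_eq_zero (Finset.mem_univ i) ?_
      rw [inv_eq_zero, Complex.Gamma_eq_zero_iff]
      refine ⟨1, ?_⟩
      have := hρ0 i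
      have := hβ i
      push_cast
      field_simp
      ring
    rw [← h0]
    exact hE.continuousAt.tendsto.mono_left nhdsWithin_le_nhds
  · refine Finset.prod_ne_zero_iff.2 fun j _ => inv_ne_zero (Complex.Gamma_ne_zero fun k hk => ?_)
    have h1 : ρ j * (1 - (1 + β i / ρ i)) = -k := by exact_mod_cast hk
    have h2 : |ρ j * (1 - (1 + β i / ρ i))| = β i := by
      rw [sub_add_cancel_left, abs_mul, abs_neg, abs_div, hρ, hρ, abs_of_pos (hβ0 i)]
      field_simp
    rw [h1, abs_neg, Nat.abs_cast] at h2
    have h3 := hβ0 i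
    have h4 := hβ1 i
    rw [← h2] at h3 h4
    have : 0 < k := by exact_mod_cast h3
    have : k < 1 := by exact_mod_cast h4
    omega

theorem not_isGenuineSingularity_stableKernel_one (hβ0 : ∀ i, 0 < β i) (hρ : ∀ i, ρ i ≠ 0) :
    ¬ IsGenuineSingularity (stableKernel β ρ) 1 := by
  rw [IsGenuineSingularity, not_not]
  refine ⟨∏ i, (β i : ℂ), ?_⟩
  unfold stableKernel
  refine tendsto_finsetProd _ fun i _ => ?_
  have hρ0 : (ρ i : ℂ) ≠ 0 := by exact_mod_cast hρ i
  refine (tendsto_Gamma_ratio (hβ0 i).ne').comp (f := fun s : ℂ => (ρ i : ℂ) * (1 - s)) ?_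
  refine tendsto_nhdsWithin_iff.2 ⟨?_, ?_⟩
  · have : ContinuousAt (fun s : ℂ => (ρ i : ℂ) * (1 - s)) 1 := by fun_prop
    simpa using this.tendsto.mono_left (nhdsWithin_le_nhds (s := {1}ᶜ))
  · filter_upwards [self_mem_nhdsWithin] with s hs
    exact mul_ne_zero hρ0 (sub_ne_zero.2 fun h => hs h.symm)

namespace IsStableFoxKernel

variable {m n p q : ℕ} {u : Fin p → ℂ × ℝ} {l : Fin q → ℂ × ℝ}

theorem kernel_eq (h : IsStableFoxKernel β ρ m n u l) :
    foxKernel m n u l = stableKernel β ρ :=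
  funext h.kernel

/-- The genuine singularity with `k = 1` confines the line to the strip where the moments of the
`i`-th factor are finite. -/
theorem neg_lt_of_isFoxContour (h : IsStableFoxKernel β ρ m n u l) (hβ0 : ∀ i, 0 < β i)
    (hβ1 : ∀ i, β i < 1) {r : ℝ} (hr : 0 < r) (hρ : ∀ i, |ρ i| = r) {c : ℝ}
    (hc : IsFoxContour m n u l c) (i : ι) : -β i < ρ i * (1 - c) := by
  have hρ0 : ρ i ≠ 0 := abs_pos.1 (by rw [hρ i]; exact hr)
  have hgen := isGenuineSingularity_stableKernel hβ0 hβ1 hr hρ i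
  rw [← h.kernel_eq] at hgen
  have hpole : (ρ i : ℂ) * (1 - ((1 + β i / ρ i : ℝ) : ℂ)) / β i = -(1 : ℕ) := by
    have h1 : (ρ i : ℂ) ≠ 0 := by exact_mod_cast hρ0
    have h2 : (β i : ℂ) ≠ 0 := by exact_mod_cast (hβ0 i).ne'
    push_cast
    field_simp
    ring
  rcases lt_or_gt_of_ne hρ0 with h0 | h0
  · have := hc.left _ ((h.left _).2 ⟨i, h0, 1, hpole⟩) hgen
    rw [Complex.ofReal_re] at this
    have h3 := mul_lt_mul_of_neg_left this h0
    rw [mul_add, mul_div_cancel₀ _ hρ0] at h3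
    linarith
  · have := hc.right _ ((h.right _).2 ⟨i, h0, 1, hpole⟩) hgen
    rw [Complex.ofReal_re] at this
    have h3 := mul_lt_mul_of_pos_left this h0
    rw [mul_add, mul_div_cancel₀ _ hρ0] at h3
    linarith

theorem ne_one_of_isFoxContour [Nonempty ι] (h : IsStableFoxKernel β ρ m n u l)
    (hρ : ∀ i, ρ i ≠ 0) {c : ℝ} (hc : IsFoxContour m n u l c) : c ≠ 1 := by
  obtain ⟨i⟩ := ‹Nonempty ι›
  rcases lt_or_gt_of_ne (hρ i) with h0 | h0
  · exact fun h1 => hc.avoids_left 1 ((h.left _).2 ⟨i, h0, 0, by simp⟩) (by simp [h1])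
  · exact fun h1 => hc.avoids_right 1 ((h.right _).2 ⟨i, h0, 0, by simp⟩) (by simp [h1])

/-- Poles with `k ≥ 1` lie on the correct side; those with `k = 0` all sit at `s = 1`, where the
kernel is regular, so either side is allowed. -/
theorem isFoxContour (h : IsStableFoxKernel β ρ m n u l) (hβ0 : ∀ i, 0 < β i)
    (hρ : ∀ i, ρ i ≠ 0) {c : ℝ} (hc1 : c ≠ 1) (hc : ∀ i, -β i < ρ i * (1 - c)) :
    IsFoxContour m n u l c := by
  have hre : ∀ (i : ι) (k : ℕ) (s : ℂ), (ρ i : ℂ) * (1 - s) / β i = -k →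
      ρ i * (1 - s.re) = -k * β i ∧ (k = 0 → s = 1) := by
    intro i k s hs
    have h2 : (β i : ℂ) ≠ 0 := by exact_mod_cast (hβ0 i).ne'
    rw [div_eq_iff h2] at hs
    refine ⟨?_, fun hk => ?_⟩
    · have := congrArg Complex.re hs
      simpa using this
    · have h3 : (ρ i : ℂ) ≠ 0 := by exact_mod_cast hρ i
      rw [hk] at hs
      simp [h3] at hs
      linear_combination -hs
  have hlt : ∀ (i : ι) (k : ℕ) (s : ℂ), (ρ i : ℂ) * (1 - s) / β i = -k → s ≠ 1 →
      ρ i * (1 - s.re) < ρ i * (1 - c) := by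
    intro i k s hs h1
    obtain ⟨h2, h3⟩ := hre i k s hs
    have hk : (1 : ℝ) ≤ k := by
      exact_mod_cast Nat.one_le_iff_ne_zero.2 fun hk => h1 (h3 hk)
    have := hc i
    have := hβ0 i
    nlinarith
  have hne : ∀ (i : ι) (k : ℕ) (s : ℂ), (ρ i : ℂ) * (1 - s) / β i = -k → s.re ≠ c := by
    intro i k s hs hsc
    by_cases h1 : s = 1
    · exact hc1 (by rw [← hsc, h1, Complex.one_re])
    · have := hlt i k s hs h1
      rw [hsc] at this
      exact lt_irrefl _ this
  have h1 := not_isGenuineSingularity_stableKernel_one hβ0 hρ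
  rw [← h.kernel_eq] at h1
  refine ⟨fun s hs => ?_, fun s hs => ?_, fun s hs hg => ?_, fun s hs hg => ?_⟩
  · obtain ⟨i, _, k, hk⟩ := (h.left _).1 hs
    exact hne i k s hk
  · obtain ⟨i, _, k, hk⟩ := (h.right _).1 hs
    exact hne i k s hk
  · obtain ⟨i, hi, k, hk⟩ := (h.left _).1 hs
    have := hlt i k s hk (fun h2 => h1 (h2 ▸ hg))
    have := (mul_lt_mul_left_of_neg hi).1 this
    linarith
  · obtain ⟨i, hi, k, hk⟩ := (h.right _).1 hs
    have := hlt i k s hk (fun h2 => h1 (h2 ▸ hg))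
    have := (mul_lt_mul_iff_right₀ hi).1 this
    linarith

theorem exists_isFoxContour (h : IsStableFoxKernel β ρ m n u l) (hβ0 : ∀ i, 0 < β i)
    (hρ : ∀ i, ρ i ≠ 0) : ∃ c : ℝ, IsFoxContour m n u l c := by
  have h1 : ∀ i, ∀ᶠ c in 𝓝[≠] (1 : ℝ), -β i < ρ i * (1 - c) := by
    intro i
    refine nhdsWithin_le_nhds ?_
    have : ContinuousAt (fun c : ℝ => ρ i * (1 - c)) 1 := by fun_prop
    exact this.eventually (lt_mem_nhds (by simpa using hβ0 i))
  obtain ⟨c, hc, hc1⟩ := ((eventually_all.2 h1).and self_mem_nhdsWithin).exists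
  exact ⟨c, h.isFoxContour hβ0 hρ hc1 hc⟩

end IsStableFoxKernel

theorem verticalIntegrable_stableKernel [Nonempty ι] (hβ0 : ∀ i, 0 < β i) (hβ1 : ∀ i, β i < 1)
    (hρ : ∀ i, ρ i ≠ 0) {c : ℝ} (hc1 : c ≠ 1) (hc : ∀ i, -β i < ρ i * (1 - c)) :
    Complex.VerticalIntegrable (stableKernel β ρ) c := by
  have ha : ∀ i, ∀ k : ℕ, ρ i * (1 - c) / β i ≠ -k := by
    intro i k hk
    rw [div_eq_iff (hβ0 i).ne'] at hk
    have h1 := hc i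
    rw [hk] at h1
    have h2 : (k : ℝ) < 1 := by
      have := hβ0 i
      by_contra hk
      nlinarith
    have h3 : k = 0 := by
      have : k < 1 := by exact_mod_cast h2
      omega
    rw [h3] at hk
    simp [hρ i] at hk
    exact hc1 (by linarith)
  choose C δ hδ hb using fun i => exists_norm_Gamma_ratio_le (hβ0 i) (hβ1 i) (ha i)
  have hw : ∀ (i : ι) (y : ℝ), (ρ i : ℂ) * (1 - (c + y * Complex.I)) =
      ((ρ i * (1 - c) : ℝ) : ℂ) + ((-ρ i * y : ℝ) : ℂ) * Complex.I := by
    intro i y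
    push_cast
    ring
  have hS : 0 < ∑ i, δ i * |ρ i| :=
    Finset.sum_pos (fun i _ => mul_pos (hδ i) (abs_pos.2 (hρ i))) Finset.univ_nonempty
  refine ((integrable_exp_neg_mul_abs hS).const_mul (∏ i, C i)).mono' ?_
    (ae_of_all _ fun y => ?_)
  · refine Continuous.aestronglyMeasurable (continuous_finsetProd _ fun i _ => ?_)
    simp only [hw]
    exact (continuous_Gamma_ratio (ha i)).comp (f := fun y : ℝ => -ρ i * y) (by fun_prop)
  · have e : Real.exp (-(∑ i, δ i * |ρ i|) * |y|) = ∏ i, Real.exp (-δ i * |(-ρ i * y)|) := by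
      rw [← Real.exp_sum, neg_mul, Finset.sum_mul, ← Finset.sum_neg_distrib]
      simp only [abs_mul, abs_neg, neg_mul, mul_assoc]
    rw [e, ← Finset.prod_mul_distrib, stableKernel, norm_prod]
    refine Finset.prod_le_prod (fun i _ => norm_nonneg _) fun i _ => ?_
    have := hb i (ρ i * (1 - (c + y * Complex.I))) (by rw [hw]; simp)
    rwa [show ((ρ i : ℂ) * (1 - (c + y * Complex.I))).im = -ρ i * y by rw [hw]; simp] at this

variable {Ω : Type*} [MeasurableSpace Ω] {P : Measure Ω}

theorem complexMGF_sum_mul {Y : ι → Ω → ℝ} (hY : ∀ i, Measurable (Y i)) (hind : iIndepFun Y P)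
    (ρ : ι → ℝ) (z : ℂ) :
    complexMGF (fun ω => ∑ i, ρ i * Y i ω) P z = ∏ i, complexMGF (Y i) P (ρ i * z) := by
  simp only [complexMGF]
  have := iIndepFun.integral_fun_prod_comp (X := Y) (μ := P)
    (f := fun i (y : ℝ) => Complex.exp (ρ i * z * y)) hind (fun i => (hY i).aemeasurable)
    (fun i => by fun_prop)
  rw [← this]
  refine integral_congr_ae (ae_of_all _ fun ω => ?_)
  simp only
  rw [← Complex.exp_sum]
  congr 1
  push_cast
  rw [Finset.mul_sum]
  exact Finset.sum_congr rfl fun i _ => by ring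

/-- The density of a product `∏ X_i ^ ρ_i`, `|ρ_i| = r`, of powers of independent positive stable
random variables. -/
theorem hasPositiveDensity_prod_rpow [IsProbabilityMeasure P] [Nonempty ι] {m n p q : ℕ} {u : Fin p → ℂ × ℝ}
    {l : Fin q → ℂ × ℝ} (h : IsStableFoxKernel β ρ m n u l) (hβ0 : ∀ i, 0 < β i)
    (hβ1 : ∀ i, β i < 1) {r : ℝ} (hr : 0 < r) (hρ : ∀ i, |ρ i| = r) {X : ι → Ω → ℝ} {τ : ι → ℝ}
    (hτ : ∀ i, 0 < τ i) (hX : ∀ i, IsPositiveStable (X i) P (β i) (τ i)) (hind : iIndepFun X P) :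
    FoxHExists m n u l ∧ HasPositiveDensity (fun ω => ∏ i, X i ω ^ ρ i) P (fun x =>
      ((∏ i, 1 / (β i * τ i ^ (ρ i / β i)) : ℝ) : ℂ) *
        foxH m n u l (x / ∏ i, τ i ^ (ρ i / β i))) := by
  have hρ0 : ∀ i, ρ i ≠ 0 := fun i => abs_pos.1 (by rw [hρ i]; exact hr)
  have hpos : ∀ᵐ ω ∂P, ∀ i, 0 < X i ω :=
    ae_all_iff.2 fun i => (hX i).ae_pos (hβ0 i) (hτ i)
  have hlog : (fun ω => Real.log (∏ i, X i ω ^ ρ i)) =ᵐ[P]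
      fun ω => ∑ i, ρ i * Real.log (X i ω) := by
    filter_upwards [hpos] with ω hω
    rw [Real.log_prod fun i _ => (Real.rpow_pos_of_pos (hω i) _).ne']
    exact Finset.sum_congr rfl fun i _ => Real.log_rpow (hω i) _
  have hYm : ∀ i, Measurable fun ω => Real.log (X i ω) := fun i => (hX i).measurable.log
  have hYind : iIndepFun (fun i ω => Real.log (X i ω)) P :=
    hind.comp (fun _ => Real.log) fun _ => Real.measurable_log
  have hτ' : ∀ i, (τ i : ℂ) ≠ 0 := fun i => by exact_mod_cast (hτ i).ne'
  refine foxHExists_and_hasPositiveDensity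
    (Finset.aemeasurable_fun_prod _ fun i _ => ((hX i).measurable.pow_const _).aemeasurable)
    ?_ h.m_le h.n_le h.upper_pos h.lower_pos (h.exists_isFoxContour hβ0 hρ0) ?_ ?_ ?_ ?_ ?_
  · filter_upwards [hpos] with ω hω
    exact Finset.prod_pos fun i _ => Real.rpow_pos_of_pos (hω i) _
  · refine Finset.prod_ne_zero_iff.2 fun i _ => ?_
    have := hβ0 i
    have := Real.rpow_pos_of_pos (hτ i) (ρ i / β i)
    positivity
  · exact Finset.prod_pos fun i _ => Real.rpow_pos_of_pos (hτ i) _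
  · intro c hc
    rw [h.kernel_eq]
    exact verticalIntegrable_stableKernel hβ0 hβ1 hρ0 (h.ne_one_of_isFoxContour hρ0 hc)
      (h.neg_lt_of_isFoxContour hβ0 hβ1 hr hρ hc)
  · intro c hc
    have hc' := h.neg_lt_of_isFoxContour hβ0 hβ1 hr hρ hc
    have hind' : iIndepFun (fun i ω => ρ i * Real.log (X i ω)) P :=
      hind.comp (fun i x => ρ i * Real.log x) fun i => by fun_prop
    have := hind'.integrable_exp_mul_sum (t := c - 1) (s := Finset.univ)
      (fun i => (hYm i).const_mul _) fun i _ => by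
        have := (hX i).integrable_exp_mul_log (hβ0 i) (hβ1 i) (hτ i) (v := (c - 1) * ρ i)
          (by linarith [hc' i])
        simpa only [mul_assoc] using this
    refine this.congr ?_
    filter_upwards [hlog] with ω hω
    rw [hω, Finset.sum_apply]
  · intro c hc y
    have hc' := h.neg_lt_of_isFoxContour hβ0 hβ1 hr hρ hc
    have hc1 := h.ne_one_of_isFoxContour hρ0 hc
    set s : ℂ := c + y * Complex.I with hs
    have hre : s.re = c := by simp [hs]
    have e1 : complexMGF (fun ω => Real.log (∏ i, X i ω ^ ρ i)) P (s - 1) =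
        complexMGF (fun ω => ∑ i, ρ i * Real.log (X i ω)) P (s - 1) := by
      refine integral_congr_ae ?_
      filter_upwards [hlog] with ω hω
      rw [hω]
    rw [e1, complexMGF_sum_mul hYm hYind, h.kernel, stableKernel, Complex.ofReal_prod,
      Complex.ofReal_prod]
    have e2 : (∏ i, ((τ i ^ (ρ i / β i) : ℝ) : ℂ)) ^ s =
        ∏ i, (((τ i ^ (ρ i / β i) : ℝ) : ℂ)) ^ s :=
      Complex.finset_prod_ofReal_cpow _ (fun i _ => Real.rpow_nonneg (hτ i).le _) s
    rw [e2, ← Finset.prod_mul_distrib, ← Finset.prod_mul_distrib]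
    refine Finset.prod_congr rfl fun i _ => ?_
    have hs0 : (ρ i : ℂ) * (1 - s) ≠ 0 := by
      refine mul_ne_zero (by exact_mod_cast hρ0 i) (sub_ne_zero.2 fun h1 => hc1 ?_)
      rw [← hre, ← h1, Complex.one_re]
    have hsre : -β i < ((ρ i : ℂ) * (1 - s)).re := by
      simpa [hre] using hc' i
    have := (hX i).complexMGF_log_neg (hβ0 i) (hβ1 i) (hτ i) hsre hs0
    have hz : (ρ i : ℂ) * (s - 1) = -(ρ i * (1 - s)) := by ring
    rw [hz, this]
    congr 1
    have hβc : (β i : ℂ) ≠ 0 := by exact_mod_cast (hβ0 i).ne'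
    -- With `b = τ^(ρ/β)` this power is `b⁻¹ b^s`: `b⁻¹` enters the constant `K`, and `b^s` rescales
    -- the argument of the Fox function.
    have e3 : (τ i : ℂ) ^ (-((ρ i : ℂ) * (1 - s)) / β i) =
        ((τ i ^ (ρ i / β i) : ℝ) : ℂ)⁻¹ * ((τ i ^ (ρ i / β i) : ℝ) : ℂ) ^ s := by
      rw [← Complex.cpow_mul_ofReal_nonneg (hτ i).le, Complex.ofReal_cpow (hτ i).le,
        ← Complex.cpow_neg, ← Complex.cpow_add _ _ (hτ' i)]
      congr 1
      push_cast
      field_simp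
      ring
    rw [e3]
    push_cast
    field_simp

end StableProducts

/-! ### Matching the Fox parameters with stable kernels -/

section Kernels

theorem isStableFoxKernel_prod {n : ℕ} {β : Fin n → ℝ} (hβ : ∀ i, 0 < β i) :
    IsStableFoxKernel β (fun _ => 1) 0 n (fun i : Fin n => ((1 - 1 / β i : ℝ), 1 / β i))
      (fun _ : Fin n => (0, 1)) where
  m_le := Nat.zero_le _
  n_le := le_rfl
  upper_pos i := one_div_pos.2 (hβ i)
  lower_pos _ := one_pos
  kernel s := by
    rw [foxKernel, stableKernel, ← Finset.prod_mul_distrib]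
    refine Finset.prod_congr rfl fun i _ => ?_
    have := hβ i
    simp only [i.isLt, if_true, Nat.not_lt_zero, if_false]
    push_cast
    congr 2
    · field_simp
      ring
    · ring_nf
  left s := by simp [foxLeftPoles, not_lt_of_gt]
  right s := by
    simp only [foxRightPoles, Set.mem_ofPred_eq, Fin.is_lt, true_and, zero_lt_one]
    refine exists_congr fun i => exists_congr fun k => ?_
    push_cast
    ring_nf

theorem isStableFoxKernel_rpow_pos {β r : ℝ} (hβ : 0 < β) (hr : 0 < r) :
    IsStableFoxKernel (fun _ : Fin 1 => β) (fun _ => r) 0 1 ![((1 - r / β : ℝ), r / β)]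
      ![((1 - r : ℝ), r)] where
  m_le := Nat.zero_le _
  n_le := le_rfl
  upper_pos i := by simpa using div_pos hr hβ
  lower_pos i := by simpa using hr
  kernel s := by
    simp [foxKernel, stableKernel]
    congr 2
    · ring
    · ring_nf
  left s := by simp [foxLeftPoles, not_lt_of_gt hr]
  right s := by
    simp [foxRightPoles, hr]
    ring_nf

/-- The coefficients of `s` in the parameters must be positive, so a negative exponent moves the
numerator Gamma factor to the lower row and its poles to the left. -/
theorem isStableFoxKernel_rpow_neg {β r : ℝ} (hβ : 0 < β) (hr : r < 0) :
    IsStableFoxKernel (fun _ : Fin 1 => β) (fun _ => r) 1 0 ![((r : ℝ), -r)]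
      ![((r / β : ℝ), -(r / β))] where
  m_le := le_rfl
  n_le := Nat.zero_le _
  upper_pos i := by simpa using hr
  lower_pos i := by simpa using div_neg_of_neg_of_pos hr hβ
  kernel s := by
    simp [foxKernel, stableKernel]
    rw [mul_comm]
    congr 2
    · ring
    · ring_nf
  left s := by
    simp [foxLeftPoles, hr]
    ring_nf
  right s := by simp [foxRightPoles, not_lt_of_gt hr]

/-- The denominators cross over: `(-1, 1)` in the upper row belongs to the divisor, `(0, 1)` in the
lower row to the dividend. -/
theorem isStableFoxKernel_div {β β' : ℝ} (hβ : 0 < β) (hβ' : 0 < β') :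
    IsStableFoxKernel ![β, β'] ![1, -1] 1 1 ![((1 - 1 / β : ℝ), 1 / β), (-1, 1)]
      ![((-1 / β' : ℝ), 1 / β'), (0, 1)] where
  m_le := one_le_two
  n_le := one_le_two
  upper_pos i := by fin_cases i <;> simp [hβ]
  lower_pos i := by fin_cases i <;> simp [hβ']
  kernel s := by
    simp [foxKernel, stableKernel, Fin.prod_univ_two]
    ring_nf
  left s := by
    simp [foxLeftPoles, Fin.exists_fin_two, not_lt_of_ge (zero_le_one' ℝ)]
    ring_nf
  right s := by
    simp [foxRightPoles, Fin.exists_fin_two, not_lt_of_ge (zero_le_one' ℝ)]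
    ring_nf

end Kernels

/-! ### The individual densities -/

section Densities

variable {Ω : Type*} [MeasurableSpace Ω] {P : Measure Ω} {X : Ω → ℝ} {β τ : ℝ}

/-- Stability under scaling reduces the scalar multiple to the power `r = 1` with a new `τ`. -/
theorem IsPositiveStable.const_mul (h : IsPositiveStable X P β τ) {a : ℝ} (ha : 0 < a) :
    IsPositiveStable (fun ω => a * X ω) P β (τ * a ^ β) where
  measurable := h.measurable.const_mul a
  nonneg := h.nonneg.mono fun _ hω => mul_nonneg ha.le hω
  laplace s hs := by
    have := h.laplace (s * a) (mul_pos hs ha)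
    rw [Real.mul_rpow hs.le ha.le] at this
    have e : ∀ ω, -s * (a * X ω) = -(s * a) * X ω := fun ω => by ring
    simp only [e, this]
    congr 1
    ring

theorem hasPositiveDensity_rpow [IsProbabilityMeasure P] (hX : IsPositiveStable X P β τ)
    (hβ0 : 0 < β) (hβ1 : β < 1) (hτ : 0 < τ) {r : ℝ} (hr : r ≠ 0) {m n p q : ℕ}
    {u : Fin p → ℂ × ℝ} {l : Fin q → ℂ × ℝ}
    (h : IsStableFoxKernel (fun _ : Fin 1 => β) (fun _ => r) m n u l) :
    FoxHExists m n u l ∧ HasPositiveDensity (fun ω => X ω ^ r) P (fun x =>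
      ((1 / (β * τ ^ (r / β)) : ℝ) : ℂ) * foxH m n u l (x / τ ^ (r / β))) := by
  have := hasPositiveDensity_prod_rpow h (fun _ => hβ0) (fun _ => hβ1) (abs_pos.2 hr)
    (fun _ => rfl) (X := fun _ => X) (τ := fun _ => τ) (fun _ => hτ) (fun _ => hX)
    (iIndepFun.of_subsingleton)
  simpa only [Finset.univ_unique, Finset.prod_singleton] using this

theorem hasPositiveDensity_const_mul [IsProbabilityMeasure P] (hX : IsPositiveStable X P β τ)
    (hβ0 : 0 < β) (hβ1 : β < 1) (hτ : 0 < τ) {a : ℝ} (ha : 0 < a) :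
    FoxHExists 0 1 ![((1 - 1 / β : ℝ), 1 / β)] ![(0, 1)] ∧
      HasPositiveDensity (fun ω => a * X ω) P (fun x =>
        ((1 / (a * β * τ ^ (1 / β)) : ℝ) : ℂ) *
          foxH 0 1 ![((1 - 1 / β : ℝ), 1 / β)] ![(0, 1)] (x / (a * τ ^ (1 / β)))) := by
  have h := hasPositiveDensity_rpow (hX.const_mul ha) hβ0 hβ1 (by positivity) one_ne_zero
    (isStableFoxKernel_rpow_pos hβ0 one_pos)
  have hl : (![(((1 - 1 : ℝ) : ℂ), (1 : ℝ))] : Fin 1 → ℂ × ℝ) = ![(0, 1)] := by simp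
  have hτa : (τ * a ^ β) ^ (1 / β) = a * τ ^ (1 / β) := by
    rw [Real.mul_rpow hτ.le (by positivity), ← Real.rpow_mul ha.le, mul_one_div_cancel hβ0.ne',
      Real.rpow_one, mul_comm]
  rw [hl] at h
  refine ⟨h.1, h.2.congr (ae_of_all _ fun ω => by simp) fun x _ => ?_⟩
  rw [hτa]
  ring_nf

theorem hasPositiveDensity_div [IsProbabilityMeasure P] {X' : Ω → ℝ} {β' τ' : ℝ}
    (hX : IsPositiveStable X P β τ) (hX' : IsPositiveStable X' P β' τ') (hβ0 : 0 < β)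
    (hβ1 : β < 1) (hβ0' : 0 < β') (hβ1' : β' < 1) (hτ : 0 < τ) (hτ' : 0 < τ')
    (hind : iIndepFun ![X, X'] P) :
    FoxHExists 1 1 ![((1 - 1 / β : ℝ), 1 / β), (-1, 1)] ![((-1 / β' : ℝ), 1 / β'), (0, 1)] ∧
      HasPositiveDensity (fun ω => X ω / X' ω) P (fun z =>
        ((1 / (β * β' * (τ ^ (1 / β) * τ' ^ (-1 / β'))) : ℝ) : ℂ) *
          foxH 1 1 ![((1 - 1 / β : ℝ), 1 / β), (-1, 1)] ![((-1 / β' : ℝ), 1 / β'), (0, 1)]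
            (z / (τ ^ (1 / β) * τ' ^ (-1 / β')))) := by
  have h := hasPositiveDensity_prod_rpow (isStableFoxKernel_div hβ0 hβ0')
    (by simp [Fin.forall_fin_two, *]) (by simp [Fin.forall_fin_two, *]) one_pos
    (by simp [Fin.forall_fin_two]) (X := ![X, X']) (τ := ![τ, τ'])
    (by simp [Fin.forall_fin_two, *])
    (by simp [Fin.forall_fin_two, *]) hind
  refine ⟨h.1, h.2.congr ?_ fun x _ => ?_⟩
  · filter_upwards [hX'.nonneg] with ω hω
    simp [Fin.prod_univ_two, Real.rpow_neg hω, div_eq_mul_inv]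
  · simp only [Fin.prod_univ_two, Matrix.cons_val_zero, Matrix.cons_val_one]
    congr 3
    rw [one_div_mul_one_div]
    ring_nf

end Densities

/-! ### Assembly of the theorem -/

theorem mainTheorem2 {Ω : Type*} [MeasurableSpace Ω] (P : Measure Ω) [IsProbabilityMeasure P]
    (n : ℕ) (hn : 1 ≤ n) (β : Fin n → ℝ) (hβ0 : ∀ i, 0 < β i) (hβ1 : ∀ i, β i < 1)
    (D : Fin n → ℝ≥0 → Ω → ℝ) (hD : ∀ i, IsStableSubordinator (D i) P (β i))
    (hindep : iIndepFun (fun i ω t => D i t ω) P) (t : ℝ≥0) (ht : 0 < t) :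
    -- scalar multiple
    (∀ i : Fin n, FoxHExists 0 1 ![((1 - 1 / β i : ℝ), 1 / β i)] ![(0, 1)] ∧
      ∀ a : ℝ, 0 < a → HasPositiveDensity (fun ω => a * D i t ω) P
        (fun x => (1 / (a * β i * (t : ℝ) ^ (1 / β i)) : ℝ) *
          foxH 0 1 ![((1 - 1 / β i : ℝ), 1 / β i)] ![(0, 1)]
            (x / (a * (t : ℝ) ^ (1 / β i))))) ∧
    -- product
    (FoxHExists 0 n (fun i : Fin n => ((1 - 1 / β i : ℝ), 1 / β i)) (fun _ : Fin n => (0, 1)) ∧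
      HasPositiveDensity (fun ω => ∏ i, D i t ω) P
        (fun y => (∏ i, 1 / (β i * (t : ℝ) ^ (1 / β i)) : ℝ) *
          foxH 0 n (fun i : Fin n => ((1 - 1 / β i : ℝ), 1 / β i)) (fun _ : Fin n => (0, 1))
            (y / (t : ℝ) ^ (∑ i, 1 / β i)))) ∧
    -- positive rational power
    (∀ (i : Fin n) (r : ℚ), 0 < r →
      FoxHExists 0 1 ![((1 - r / β i : ℝ), r / β i)] ![((1 - r : ℝ), (r : ℝ))] ∧
      HasPositiveDensity (fun ω => D i t ω ^ (r : ℝ)) P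
        (fun w => (1 / (β i * (t : ℝ) ^ (r / β i)) : ℝ) *
          foxH 0 1 ![((1 - r / β i : ℝ), r / β i)] ![((1 - r : ℝ), (r : ℝ))]
            (w / (t : ℝ) ^ (r / β i)))) ∧
    -- negative rational power
    (∀ (i : Fin n) (r : ℚ), r < 0 →
      FoxHExists 1 0 ![((r : ℝ), -(r : ℝ))] ![((r / β i : ℝ), -(r / β i))] ∧
      HasPositiveDensity (fun ω => D i t ω ^ (r : ℝ)) P
        (fun w => (1 / (β i * (t : ℝ) ^ (r / β i)) : ℝ) *
          foxH 1 0 ![((r : ℝ), -(r : ℝ))] ![((r / β i : ℝ), -(r / β i))]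
            (w / (t : ℝ) ^ (r / β i)))) ∧
    -- quotient
    (∀ i j : Fin n, i ≠ j →
      FoxHExists 1 1 ![((1 - 1 / β i : ℝ), 1 / β i), (-1, 1)]
        ![((-1 / β j : ℝ), 1 / β j), (0, 1)] ∧
      HasPositiveDensity (fun ω => D i t ω / D j t ω) P
        (fun z => (1 / (β i * β j * (t : ℝ) ^ (1 / β i - 1 / β j)) : ℝ) *
          foxH 1 1 ![((1 - 1 / β i : ℝ), 1 / β i), (-1, 1)]
            ![((-1 / β j : ℝ), 1 / β j), (0, 1)]
            (z / (t : ℝ) ^ (1 / β i - 1 / β j)))) := by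
  have htr : (0 : ℝ) < t := ht
  have hS : ∀ i, IsPositiveStable (D i t) P (β i) t := fun i =>
    (hD i).isPositiveStable (hβ0 i) (hβ1 i) t
  have hI : iIndepFun (fun i => D i t) P :=
    hindep.comp (fun _ f => f t) fun _ => measurable_pi_apply t
  refine ⟨fun i => ⟨?_, fun a ha => ?_⟩, ?_, fun i r hr => ?_, fun i r hr => ?_, fun i j hij => ?_⟩
  -- The Fox function does not involve the scalar, so the value `1` serves.
  · exact (hasPositiveDensity_const_mul (hS i) (hβ0 i) (hβ1 i) htr one_pos).1
  · exact (hasPositiveDensity_const_mul (hS i) (hβ0 i) (hβ1 i) htr ha).2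
  · have : Nonempty (Fin n) := ⟨⟨0, hn⟩⟩
    have h := hasPositiveDensity_prod_rpow (isStableFoxKernel_prod hβ0) hβ0 hβ1 one_pos
      (fun _ => abs_one) (fun _ => htr) hS hI
    refine ⟨h.1, h.2.congr (ae_of_all _ fun ω => by simp) fun x _ => ?_⟩
    rw [Real.rpow_sum_of_pos htr]
  · have hr' : (0 : ℝ) < r := by exact_mod_cast hr
    exact hasPositiveDensity_rpow (hS i) (hβ0 i) (hβ1 i) htr hr'.ne'
      (isStableFoxKernel_rpow_pos (hβ0 i) hr')
  · have hr' : (r : ℝ) < 0 := by exact_mod_cast hr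
    exact hasPositiveDensity_rpow (hS i) (hβ0 i) (hβ1 i) htr hr'.ne
      (isStableFoxKernel_rpow_neg (hβ0 i) hr')
  · have hpair : iIndepFun ![D i t, D j t] P := by
      have hinj : Function.Injective ![i, j] := by
        intro a b
        fin_cases a <;> fin_cases b <;> simp [hij, hij.symm]
      have := hI.precomp hinj
      convert this using 1
      ext k
      fin_cases k <;> rfl
    have h := hasPositiveDensity_div (hS i) (hS j) (hβ0 i) (hβ1 i) (hβ0 j) (hβ1 j) htr htr hpair
    refine ⟨h.1, h.2.congr (ae_of_all _ fun ω => rfl) fun x _ => ?_⟩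
    rw [← Real.rpow_add htr]
    ring_nf
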